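/- Let $x,y:\mathbb R\to\mathbb R$ be smooth $1$-periodic functions with $x>0$ and $r^2:=x'^2+y'^2>0$ everywhere, such that $x$ is a Morse function whose critical points in $\mathbb R/\mathbb Z$ have pairwise distinct critical values. Put $\Sigma(\varphi,s)=(x(s)\cos 2\pi\varphi,\;x(s)\sin 2\pi\varphi,\;y(s))$, let $\mathbb T^2=\mathbb R^2/\mathbb Z^2$ carry the metric $g$ that $\Sigma$ pulls back from the Euclidean metric of $\mathbb R^3$, and let $H=\tfrac12 g^*(p,p)=\tfrac12\Big(\frac{p_\varphi^2}{4\pi^2x(s)^2}+\frac{p_s^2}{r(s)^2}\Big)$ be the geodesic Hamiltonian on $T^*\mathbb T^2$. Definitions. Let $f$ be a smooth first integral of the Hamiltonian flow $\phi_H$ and $\mathcal E$ a compact regular energy level. The triple $(\mathcal E,\phi_H,f)$ is a nondegenerate Bott system if the critical points of $f|_{\mathcal E}$ form strict submanifolds of $\mathcal E$ such that the Hessian of $f|_{\mathcal E}$ is nondegenerate on their normal spaces. A critical circle is a connected component of the critical set of $f|_{\mathcal E}$ that is homeomorphic to a circle. A periodic orbit in $\mathcal E$ with minimal period $T>0$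 is elliptic if its linearized Poincaré map (the map induced by $D\phi_H^T$ on $T\mathcal E$ modulo the direction of the Hamiltonian vector field) is conjugate to a rotation, of some angle $\alpha\in\mathbb R$, so that the eigenvalues of $D\phi_H^T$ on $T\mathcal E$ are $1,e^{i\alpha},e^{-i\alpha}$; it is hyperbolic if the eigenvalues of $D\phi_H^T$ on $T\mathcal E$ are $1,e^{\lambda},e^{-\lambda}$ with $\lambda>0$. A nondegenerate Bott system is dynamically coherent if each critical circle is an elliptic or a hyperbolic periodic orbit. Proposition 4.1. The flow $\phi_H$ is complete, and for every $e>0$ the system $(H^{-1}(e),\phi_H,p_\varphi|_{H^{-1}(e)})$ is dynamically coherent (in particular a nondegenerate Bott system). The critical set of $p_\varphi|_{H^{-1}(e)}$ is the union of the circles $$\mathcal C_s^{\pm}=\{(\varphi,s,p_\varphi,p_s)\;:\;\varphi\in\mathbb R/\mathbb Z,\ p_\varphi=\pm2\pi\sqrt{2e}\,x(s),\ p_s=0\},\qquad x'(s)=0,$$ and these are exactly its critical circles. $\mathcal C_s^\pm$ is an elliptic periodic orbit if $s$ is a local maximum of $x$ and a hyperbolic periodic orbit if $s$ is a local minimum of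 $x$. Consequently at least one critical circle is a hyperbolic periodic orbit. -/

import Mathlib

open scoped ContDiff

noncomputable section

namespace RevolutionTorus

/-! ### The surface of revolution and its metric -/

/-- The pairs `(x, y)` that define a torus of revolution: `x, y` are smooth and `1`-periodic,
`x` is positive, and the meridian curve `(x, y)` is regular, i.e. `x'² + y'²` (the square of the
function `r`) is positive, so that the Euclidean metric induces a Riemannian metric. -/
structure IsTorusProfile (x y : ℝ → ℝ) : Prop where
  smooth_x : ContDiff ℝ ∞ x
  smooth_y : ContDiff ℝ ∞ y
  periodic_x : Function.Periodic x 1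
  periodic_y : Function.Periodic y 1
  pos_x : ∀ s, 0 < x s
  regular : ∀ s, 0 < deriv x s ^ 2 + deriv y s ^ 2

/-- The profiles of the class `𝒯_ℳ`: moreover `x` is a Morse function, and two critical points of
`x` with the same critical value coincide in `ℝ/ℤ`. -/
structure IsMorseTorusProfile (x y : ℝ → ℝ) : Prop extends IsTorusProfile x y where
  morse : ∀ s, deriv x s = 0 → deriv (deriv x) s ≠ 0
  once : ∀ s t, deriv x s = 0 → deriv x t = 0 → x s = x t →
    (s : UnitAddCircle) = (t : UnitAddCircle)

/-- The parametrization `(φ, s) ↦ (x(s) cos 2πφ, x(s) sin 2πφ, y(s))`. -/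
def surfaceMap (x y : ℝ → ℝ) (q : ℝ × ℝ) : EuclideanSpace ℝ (Fin 3) :=
  !₂[x q.2 * Real.cos (2 * Real.pi * q.1), x q.2 * Real.sin (2 * Real.pi * q.1), y q.2]

/-- The coordinate vector fields `∂_φ, ∂_s` of the plane. -/
def coordVec : Fin 2 → ℝ × ℝ := ![(1, 0), (0, 1)]

/-- The matrix, in the coordinates `(φ, s)`, of the pull-back of the Euclidean metric. -/
def metricMatrix (x y : ℝ → ℝ) (q : ℝ × ℝ) : Matrix (Fin 2) (Fin 2) ℝ :=
  Matrix.of fun i j =>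
    inner ℝ (fderiv ℝ (surfaceMap x y) q (coordVec i)) (fderiv ℝ (surfaceMap x y) q (coordVec j))

/-! ### Phase spaces -/

/-- `T*ℝ²`, with coordinates `((φ, s), (p_φ, p_s))`. -/
abbrev CotPlane : Type := (ℝ × ℝ) × (ℝ × ℝ)

/-- `T*𝕋²`, with `𝕋² = ℝ²/ℤ²` and the coordinates `(p_φ, p_s)` on the fibres. -/
abbrev CotTorus : Type := (UnitAddCircle × UnitAddCircle) × (ℝ × ℝ)

/-- The covering `T*ℝ² → T*𝕋²`. It is the quotient by integral translations of `(φ, s)`. The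
differential calculus on `T*𝕋²` is that of lifts: a function on `T*𝕋²` is differentiated by
composing it with `cotProj`, and `T_{cotProj z} T*𝕋²` is identified with `T_z T*ℝ² = CotPlane`
by the derivative of `cotProj` (the derivative of a deck translation is the identity). -/
def cotProj (z : CotPlane) : CotTorus := (((z.1.1 : UnitAddCircle), (z.1.2 : UnitAddCircle)), z.2)

/-! ### The geodesic Hamiltonian and the Clairaut integral -/

/-- The geodesic Hamiltonian on `T*ℝ²`: half of the dual metric, `H(q, p) = ½ pᵀ g(q)⁻¹ p`. -/
def planeHamiltonian (x y : ℝ → ℝ) (z : CotPlane) : ℝ :=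
  (1 / 2) * (![z.2.1, z.2.2] ⬝ᵥ (Matrix.mulVec (metricMatrix x y z.1)⁻¹ ![z.2.1, z.2.2]))

/-- The geodesic Hamiltonian on `T*𝕋²`, evaluated at the representative in `[0, 1)²` of the base
point; see `torusHamiltonian_cotProj`. -/
def torusHamiltonian (x y : ℝ → ℝ) (z : CotTorus) : ℝ :=
  planeHamiltonian x y
    (((AddCircle.equivIco 1 0 z.1.1 : ℝ), (AddCircle.equivIco 1 0 z.1.2 : ℝ)), z.2)

/-- The Clairaut integral `p_φ` on `T*𝕋²`. -/
def clairaut (z : CotTorus) : ℝ := z.2.1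

theorem surfaceMap_add_int {x y : ℝ → ℝ} (hx : Function.Periodic x 1)
    (hy : Function.Periodic y 1) (m n : ℤ) (q : ℝ × ℝ) :
    surfaceMap x y (q + ((m : ℝ), (n : ℝ))) = surfaceMap x y q := by
  have h1 : x (q.2 + n) = x q.2 := by simpa using hx.int_mul n q.2
  have h2 : y (q.2 + n) = y q.2 := by simpa using hy.int_mul n q.2
  have h3 : 2 * Real.pi * (q.1 + m) = 2 * Real.pi * q.1 + m * (2 * Real.pi) := by ring
  simp only [surfaceMap, Prod.fst_add, Prod.snd_add, h1, h2, h3, Real.cos_add_int_mul_two_pi,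
    Real.sin_add_int_mul_two_pi]

theorem planeHamiltonian_add_int {x y : ℝ → ℝ} (hx : Function.Periodic x 1)
    (hy : Function.Periodic y 1) (m n : ℤ) (q p : ℝ × ℝ) :
    planeHamiltonian x y (q + ((m : ℝ), (n : ℝ)), p) = planeHamiltonian x y (q, p) := by
  have h : fderiv ℝ (surfaceMap x y) (q + ((m : ℝ), (n : ℝ))) = fderiv ℝ (surfaceMap x y) q := by
    rw [← fderiv_comp_add_right]
    congr 1
    funext w
    exact surfaceMap_add_int hx hy m n w
  simp only [planeHamiltonian, metricMatrix, h]

/-- The Hamiltonian on `T*𝕋²` is the one that the Hamiltonian on `T*ℝ²` projects to. -/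
theorem torusHamiltonian_cotProj {x y : ℝ → ℝ} (hx : Function.Periodic x 1)
    (hy : Function.Periodic y 1) (z : CotPlane) :
    torusHamiltonian x y (cotProj z) = planeHamiltonian x y z := by
  have key : ∀ a : ℝ, ∃ k : ℤ,
      ((AddCircle.equivIco (1 : ℝ) 0 (a : UnitAddCircle) : Set.Ico (0 : ℝ) (0 + 1)) : ℝ)
        = a + k := by
    intro a
    refine ⟨-⌊a⌋, ?_⟩
    rw [AddCircle.coe_equivIco_mk_apply]
    simp [Int.fract, sub_eq_add_neg]
  obtain ⟨m, hm⟩ := key z.1.1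
  obtain ⟨n, hn⟩ := key z.1.2
  have := planeHamiltonian_add_int hx hy m n z.1 z.2
  simp only [torusHamiltonian, cotProj]
  rw [hm, hn]
  exact this

/-! ### Hamiltonian systems on `T*𝕋²` -/

/-- The Hamiltonian vector field of `H` for the symplectic structure of the Liouville form
`p_φ dφ + p_s ds`: `φ' = ∂H/∂p_φ`, `s' = ∂H/∂p_s`, `p_φ' = -∂H/∂φ`, `p_s' = -∂H/∂s`. -/
def hamVec (H : CotTorus → ℝ) (z : CotPlane) : CotPlane :=
  ((fderiv ℝ (H ∘ cotProj) z ((0, 0), (1, 0)), fderiv ℝ (H ∘ cotProj) z ((0, 0), (0, 1))),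
   (-fderiv ℝ (H ∘ cotProj) z ((1, 0), (0, 0)), -fderiv ℝ (H ∘ cotProj) z ((0, 1), (0, 0))))

/-- `φ` is the (complete) Hamiltonian flow of `H` on `T*𝕋²`, and `Φ` is its lift to `T*ℝ²`. -/
structure IsHamiltonianFlow (H : CotTorus → ℝ) (Φ : ℝ → CotPlane → CotPlane)
    (φ : ℝ → CotTorus → CotTorus) : Prop where
  zero : ∀ z, Φ 0 z = z
  hasDerivAt : ∀ t z, HasDerivAt (fun τ => Φ τ z) (hamVec H (Φ t z)) t
  proj : ∀ t z, φ t (cotProj z) = cotProj (Φ t z)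

/-- The energy level `H⁻¹(e)` in `T*𝕋²`. -/
def energyLevel (H : CotTorus → ℝ) (e : ℝ) : Set CotTorus := {z | H z = e}

/-- The tangent space `ker dH(z)` of the (regular) energy level through `cotProj z`. -/
def levelTangent (H : CotTorus → ℝ) (z : CotPlane) : Submodule ℝ CotPlane :=
  LinearMap.ker (fderiv ℝ (H ∘ cotProj) z : CotPlane →ₗ[ℝ] ℝ)

/-- The lift to `T*ℝ²` of the set of critical points of `f` restricted to `H⁻¹(e)`: the points of
the level where `df` vanishes on the tangent space of the level. -/
def critLift (H f : CotTorus → ℝ) (e : ℝ) : Set CotPlane :=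
  {z | cotProj z ∈ energyLevel H e ∧ ∀ u ∈ levelTangent H z, fderiv ℝ (f ∘ cotProj) z u = 0}

/-- The set of critical points of `f` restricted to `H⁻¹(e)`, in `T*𝕋²`. -/
def critSet (H f : CotTorus → ℝ) (e : ℝ) : Set CotTorus := cotProj '' critLift H f e

/-- `S` is, near its point `z`, an embedded smooth submanifold with tangent space `V` at `z`:
near `z` it is the zero set of a smooth map to some `ℝᵏ` that is a submersion at `z`. -/
def IsSubmanifoldAt (S : Set CotPlane) (z : CotPlane) (V : Submodule ℝ CotPlane) : Prop :=
  ∃ (k : ℕ) (G : CotPlane → EuclideanSpace ℝ (Fin k)) (U : Set CotPlane),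
    IsOpen U ∧ z ∈ U ∧ ContDiffOn ℝ ∞ G U ∧ S ∩ U = {w ∈ U | G w = 0} ∧
    Function.Surjective (fderiv ℝ G z) ∧
    V = LinearMap.ker (fderiv ℝ G z : CotPlane →ₗ[ℝ] EuclideanSpace ℝ (Fin k))

/-- The Hessian at `z` of `f` restricted to the energy level of `H` is nondegenerate in the
directions normal to `V`: its kernel, as a bilinear form on `ker dH(z)`, lies in `V`. At a critical
point, where `df = c dH`, this Hessian is the restriction of `D²f - c D²H` to `ker dH(z)`. -/
def HessianNondegenerateNormalTo (H f : CotTorus → ℝ) (z : CotPlane)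
    (V : Submodule ℝ CotPlane) : Prop :=
  ∃ c : ℝ, fderiv ℝ (f ∘ cotProj) z = c • fderiv ℝ (H ∘ cotProj) z ∧
    ∀ u ∈ levelTangent H z,
      (∀ v ∈ levelTangent H z, fderiv ℝ (fderiv ℝ (f ∘ cotProj)) z u v
        - c * fderiv ℝ (fderiv ℝ (H ∘ cotProj)) z u v = 0) → u ∈ V

/-- `(H⁻¹(e), φ, f)` is a nondegenerate Bott system: `H⁻¹(e)` is a compact regular level, `f` is a
smooth first integral, and the critical points of `f` restricted to `H⁻¹(e)` form nondegenerate
strict submanifolds of `H⁻¹(e)`. -/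
structure IsBottSystem (H f : CotTorus → ℝ) (e : ℝ) (φ : ℝ → CotTorus → CotTorus) : Prop where
  smooth_H : ContDiff ℝ ∞ (H ∘ cotProj)
  smooth_f : ContDiff ℝ ∞ (f ∘ cotProj)
  isCompact : IsCompact (energyLevel H e)
  regular : ∀ z, cotProj z ∈ energyLevel H e → fderiv ℝ (H ∘ cotProj) z ≠ 0
  firstIntegral : ∀ t z, f (φ t z) = f z
  bott : ∀ z ∈ critLift H f e, ∃ V : Submodule ℝ CotPlane,
    IsSubmanifoldAt (critLift H f e) z V ∧ V < levelTangent H z ∧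
    HessianNondegenerateNormalTo H f z V

/-- A critical circle: a connected component of the critical set that is a circle. -/
def IsCriticalCircle (H f : CotTorus → ℝ) (e : ℝ) (C : Set CotTorus) : Prop :=
  (∃ z ∈ critSet H f e, C = connectedComponentIn (critSet H f e) z) ∧
    Nonempty (C ≃ₜ UnitAddCircle)

/-- `C` is a periodic orbit of `φ` with minimal period `T > 0`. -/
def IsPeriodicOrbit (φ : ℝ → CotTorus → CotTorus) (C : Set CotTorus) (T : ℝ) : Prop :=
  0 < T ∧ C.Nonempty ∧ ∀ z ∈ C, φ T z = z ∧ (∀ t, 0 < t → t < T → φ t z ≠ z) ∧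
    C = Set.range fun t => φ t z

/-- `C` is an elliptic periodic orbit (in its energy level): the linearized Poincaré map, that is,
the map induced by the derivative `A` of the time `T` map on `ker dH(z)` modulo the line of the
Hamiltonian vector field, is conjugate to a rotation. Thus the eigenvalues of `A` on the tangent
space of the energy level are `1, exp (iα), exp (-iα)`. -/
def IsEllipticOrbit (H : CotTorus → ℝ) (Φ : ℝ → CotPlane → CotPlane)
    (φ : ℝ → CotTorus → CotTorus) (C : Set CotTorus) : Prop :=
  ∃ T, IsPeriodicOrbit φ C T ∧ ∀ z, cotProj z ∈ C →
    ∃ A : CotPlane →L[ℝ] CotPlane, HasFDerivAt (Φ T) A z ∧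
      ∃ u ∈ levelTangent H z, ∃ v ∈ levelTangent H z,
        LinearIndependent ℝ ![hamVec H z, u, v] ∧
        ∃ α a b : ℝ, A u = Real.cos α • u + Real.sin α • v + a • hamVec H z ∧
          A v = -Real.sin α • u + Real.cos α • v + b • hamVec H z

/-- `C` is a hyperbolic periodic orbit (in its energy level): the eigenvalues of the derivative of
the time `T` map on the tangent space of the energy level are `1, exp l, exp (-l)` for some
`l > 0`, the eigenvalue `1` being that of the Hamiltonian vector field. -/
def IsHyperbolicOrbit (H : CotTorus → ℝ) (Φ : ℝ → CotPlane → CotPlane)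
    (φ : ℝ → CotTorus → CotTorus) (C : Set CotTorus) : Prop :=
  ∃ T, IsPeriodicOrbit φ C T ∧ ∀ z, cotProj z ∈ C →
    ∃ A : CotPlane →L[ℝ] CotPlane, HasFDerivAt (Φ T) A z ∧
      ∃ u ∈ levelTangent H z, ∃ v ∈ levelTangent H z,
        LinearIndependent ℝ ![hamVec H z, u, v] ∧
        ∃ l : ℝ, 0 < l ∧ A u = Real.exp l • u ∧ A v = Real.exp (-l) • v

/-- `(H⁻¹(e), φ, f)` is dynamically coherent: it is a nondegenerate Bott system whose critical
circles are elliptic or hyperbolic periodic orbits. -/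
def IsDynamicallyCoherent (H f : CotTorus → ℝ) (e : ℝ) (Φ : ℝ → CotPlane → CotPlane)
    (φ : ℝ → CotTorus → CotTorus) : Prop :=
  IsBottSystem H f e φ ∧ ∀ C, IsCriticalCircle H f e C →
    IsEllipticOrbit H Φ φ C ∨ IsHyperbolicOrbit H Φ φ C

/-- The circle of the covectors of energy `e` over the parallel of `s` that are tangent to it,
`{((φ, s), (σ 2π √(2e) x(s), 0))}`; the sign `σ = 1` or `-1` gives the sense of rotation. -/
def parallelCircle (x : ℝ → ℝ) (e s σ : ℝ) : Set CotTorus :=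
  Set.range fun φ : UnitAddCircle =>
    (((φ, (s : UnitAddCircle)), (σ * (2 * Real.pi * Real.sqrt (2 * e) * x s), 0)) : CotTorus)

end RevolutionTorus

end

open RevolutionTorus

/-! The metric is diagonal in (φ, s), so H = ½(a(s) p_φ² + b(s) p_s²) with a = 1/(4π²x²) and b =
1/r². Nothing depends on φ, hence p_φ is conserved. On a level e > 0 the form dp_φ is a multiple of
dH exactly where p_s = 0 and a'(s) = 0, that is x'(s) = 0; the energy then forces p_φ = ±2π√(2e)
x(s) (`mem_critLift_clairaut`, `critSet_eq`). There a'' is a negative multiple of x'', and the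
restricted Hessian is a nonzero multiple of diag(a'' p_φ²/2, b) in (s, p_s), so the Morse condition
on x gives the Bott condition (`isBottSystem_clairaut`).

A critical circle moves along itself at constant speed and the field is invariant under rotations,
so the linearized flow has constant coefficients and the return map has derivative exp(T L)
(`hasFDerivAt_flow`). In the (s, p_s) plane L reads δs' = b δp_s, δp_s' = -(a'' p_φ²/2) δs: an
oscillator over maxima of x, a saddle over minima. The global minimum of x provides a hyperbolic
orbit.

The circles are the components of the critical set because p_φ takes only countably many values
there: it is constant on a component, and its sign and size single out one critical point of x
modulo 1 (`connectedComponentIn_critSet`).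

For completeness, a sublevel set of H is compact modulo translations, so cutting the field off at
high energy makes it bounded and Lipschitz without changing the orbits below (`cutVec`). -/

noncomputable section

namespace RevolutionTorus

/-! ### Ordinary differential equations -/

section ODE

variable {E : Type*} [NormedAddCommGroup E] [NormedSpace ℝ E]

/-- A bounded Lipschitz vector field has an integral curve on any compact time interval. -/
theorem exists_hasDerivAt_Icc [CompleteSpace E] {v : E → E} {K B : NNReal}
    (hv : LipschitzWith K v) (hB : ∀ z, ‖v z‖ ≤ B) (z : E) (T : NNReal) :
    ∃ γ : ℝ → E, γ 0 = z ∧ ∀ t ∈ Set.Ioo (-T : ℝ) T, HasDerivAt γ (v (γ t)) t := by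
  have h0 : (0 : ℝ) ∈ Set.Icc (-T : ℝ) T := ⟨by simp, by simp⟩
  -- Speed at most `B` during time `T` keeps the curve in the ball of radius `B * T`.
  have hP : IsPicardLindelof (fun _ : ℝ => v) (⟨0, h0⟩ : Set.Icc (-T : ℝ) T) z (B * T) 0 B K := by
    refine ⟨fun t _ => hv.lipschitzOnWith, fun _ _ => continuousOn_const, fun _ _ z _ => hB z, ?_⟩
    simp
  obtain ⟨γ, h1, h2⟩ := hP.exists_eq_forall_mem_Icc_hasDerivWithinAt₀
  exact ⟨γ, h1, fun t ht => (h2 t ⟨ht.1.le, ht.2.le⟩).hasDerivAt (Icc_mem_nhds ht.1 ht.2)⟩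

/-- A bounded Lipschitz vector field has global integral curves. -/
theorem exists_hasDerivAt_of_lipschitzWith [CompleteSpace E] {v : E → E} {K B : NNReal}
    (hv : LipschitzWith K v) (hB : ∀ z, ‖v z‖ ≤ B) (z : E) :
    ∃ γ : ℝ → E, γ 0 = z ∧ ∀ t, HasDerivAt γ (v (γ t)) t := by
  choose γ h0 hγ using fun T : NNReal => exists_hasDerivAt_Icc hv hB z T
  have huniq : ∀ S T : NNReal, S ≤ T → Set.EqOn (γ S) (γ T) (Set.Ioo (-S : ℝ) S) := by
    intro S T hST
    rcases eq_or_ne S 0 with rfl | hS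
    · simp [Set.EqOn]
    have hS' : (0 : ℝ) < S := by positivity
    refine ODE_solution_unique_of_mem_Ioo (v := fun _ => v) (s := fun _ => Set.univ)
      (fun _ _ => hv.lipschitzOnWith) (t₀ := 0) ⟨by linarith, hS'⟩
      (fun t ht => ⟨hγ S t ht, trivial⟩) (fun t ht => ⟨hγ T t ?_, trivial⟩) (by rw [h0, h0])
    have : (S : ℝ) ≤ T := hST
    exact ⟨by linarith [ht.1], by linarith [ht.2]⟩
  -- The local solutions agree on overlaps; the `+ 1` makes `t` interior to the interval used at
  -- `t`.
  refine ⟨fun t => γ (‖t‖₊ + 1) t, by simp [h0], fun t => ?_⟩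
  have ht : t ∈ Set.Ioo (-(‖t‖₊ + 1 : NNReal) : ℝ) (‖t‖₊ + 1 : NNReal) := by
    simp only [NNReal.coe_add, coe_nnnorm, Real.norm_eq_abs, NNReal.coe_one, Set.mem_Ioo]
    exact ⟨by linarith [neg_abs_le t], by linarith [le_abs_self t]⟩
  refine (hγ (‖t‖₊ + 1) t ht).congr_of_eventuallyEq ?_
  filter_upwards [Ioo_mem_nhds ht.1 ht.2] with τ hτ
  have hτ' : τ ∈ Set.Ioo (-(‖τ‖₊ + 1 : NNReal) : ℝ) (‖τ‖₊ + 1 : NNReal) := by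
    simp only [NNReal.coe_add, coe_nnnorm, Real.norm_eq_abs, NNReal.coe_one, Set.mem_Ioo]
    exact ⟨by linarith [neg_abs_le τ], by linarith [le_abs_self τ]⟩
  rcases le_total (‖t‖₊ + 1) (‖τ‖₊ + 1) with h | h
  · exact (huniq _ _ h hτ).symm
  · exact huniq _ _ h hτ'

theorem hasDerivAt_exp_smul_apply [CompleteSpace E] (L : E →L[ℝ] E) (u : E) (t : ℝ) :
    HasDerivAt (fun τ : ℝ => NormedSpace.exp (τ • L) u) (L (NormedSpace.exp (t • L) u)) t := by
  have h := (hasDerivAt_exp_smul_const' (𝕂 := ℝ) L t).clm_apply (hasDerivAt_const t u)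
  simpa using h

/-- A solution of the linear equation `y' = L y` is given by the exponential of `L`. -/
theorem eq_exp_smul_apply [CompleteSpace E] {L : E →L[ℝ] E} {y : ℝ → E}
    (hy : ∀ t, HasDerivAt y (L (y t)) t) (t : ℝ) : y t = NormedSpace.exp (t • L) (y 0) := by
  have := ODE_solution_unique_univ (v := fun _ => L) (s := fun _ => Set.univ) (t₀ := 0)
    (fun _ => L.lipschitz.lipschitzOnWith) (fun t => ⟨hy t, trivial⟩)
    (fun t => ⟨hasDerivAt_exp_smul_apply L (y 0) t, trivial⟩) (by simp)
  exact congrFun this t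

/-- If the linearization `L` of a Lipschitz vector field is the same at all points of an integral
curve, the flow is differentiable at the starting point of the curve, with derivative the
exponential of `L`. -/
theorem hasFDerivAt_flow [CompleteSpace E] {v : E → E} {K : NNReal} (hv : LipschitzWith K v)
    {Φ : ℝ → E → E} {z : E} {L : E →L[ℝ] E} (hL : HasFDerivAt v L z)
    (hinv : ∀ t w, v (Φ t z + w) = v (z + w)) (h0 : ∀ w, Φ 0 w = w)
    (hΦ : ∀ᶠ w in nhds z, ∀ t, HasDerivAt (fun τ => Φ τ w) (v (Φ t w)) t) {T : ℝ} (hT : 0 ≤ T) :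
    HasFDerivAt (Φ T) (NormedSpace.exp (T • L) : E →L[ℝ] E) z := by
  set A : ℝ → E →L[ℝ] E := fun t => NormedSpace.exp (t • L) with hA
  have hAc : Continuous A := by
    rw [continuous_iff_continuousAt]
    exact fun t => (hasDerivAt_exp_smul_const' (𝕂 := ℝ) L t).continuousAt
  obtain ⟨M, hM⟩ := (isCompact_Icc (a := 0) (b := T)).exists_bound_of_continuousOn hAc.continuousOn
  have hM0 : 0 ≤ M := (norm_nonneg _).trans (hM 0 ⟨le_rfl, hT⟩)
  rw [hasFDerivAt_iff_isLittleO_nhds_zero, Asymptotics.isLittleO_iff]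
  intro c hc
  -- The constant `K + 1` is nonzero, which selects the branch of the Grönwall bound that is linear
  -- in the error.
  set G := gronwallBound 0 (K + 1) 1 T with hG
  have hGe : ∀ ε, gronwallBound 0 (K + 1) ε T = ε * G := by
    have : (K : ℝ) + 1 ≠ 0 := by positivity
    intro ε
    simp only [hG, gronwallBound_of_K_ne_0 this]
    ring
  have hG0 : 0 ≤ G := by
    have : (K : ℝ) + 1 ≠ 0 := by positivity
    simp only [hG, gronwallBound_of_K_ne_0 this]
    have : 1 ≤ Real.exp ((K + 1) * T) := Real.one_le_exp (by positivity)
    have : 0 ≤ Real.exp ((K + 1) * T) - 1 := by linarith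
    positivity
  -- The final Grönwall error is `ε * M * G * ‖h‖`; this choice makes it at most `c * ‖h‖`.
  set ε := c / ((M + 1) * (G + 1)) with hε
  have hε0 : 0 < ε := by positivity
  have h1 := hL
  rw [hasFDerivAt_iff_isLittleO_nhds_zero, Asymptotics.isLittleO_iff] at h1
  obtain ⟨δ, hδ, hδ'⟩ := Metric.eventually_nhds_iff.1 (h1 hε0)
  have hΦ' : ∀ᶠ h in nhds (0 : E), ∀ t, HasDerivAt (fun τ => Φ τ (z + h)) (v (Φ t (z + h))) t := by
    have : Filter.Tendsto (fun h => z + h) (nhds 0) (nhds z) := by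
      have : Continuous fun h => z + h := by fun_prop
      simpa using this.tendsto 0
    exact this.eventually hΦ
  have hz : ∀ t, HasDerivAt (fun τ => Φ τ z) (v (Φ t z)) t := hΦ.self_of_nhds
  -- The radius keeps `A t h`, of norm at most `M * ‖h‖`, in the `δ`-ball where `L` approximates `v`
  -- up to `ε`.
  filter_upwards [hΦ', Metric.ball_mem_nhds (0 : E) (show 0 < δ / (M + 1) by positivity)]
    with h hh hhδ
  rw [mem_ball_zero_iff, lt_div_iff₀ (by positivity)] at hhδ
  have hAh : ∀ t ∈ Set.Icc 0 T, ‖A t h‖ ≤ M * ‖h‖ := fun t ht =>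
    (A t).le_of_opNorm_le (hM t ht) h
  have hg : ∀ t, HasDerivAt (fun τ => Φ τ z + A τ h) (v (Φ t z) + L (A t h)) t := fun t =>
    (hz t).add (hasDerivAt_exp_smul_apply L h t)
  -- The true orbit of `z + h` is compared with the affine guess `Φ t z + A t h`, which solves the
  -- equation up to the linearization error.
  have key := dist_le_of_approx_trajectories_ODE (v := fun _ => v) (K := K + 1)
    (f := fun τ => Φ τ (z + h)) (g := fun τ => Φ τ z + A τ h) (f' := fun t => v (Φ t (z + h)))
    (g' := fun t => v (Φ t z) + L (A t h)) (a := 0) (b := T) (εf := 0) (εg := ε * (M * ‖h‖))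
    (δ := 0) (fun _ => hv.weaken (by simp))
    (fun t _ => (hh t).continuousAt.continuousWithinAt) (fun t _ => (hh t).hasDerivWithinAt)
    (fun t _ => by simp) (fun t _ => (hg t).continuousAt.continuousWithinAt)
    (fun t _ => (hg t).hasDerivWithinAt) (fun t ht => ?_) (by simp [h0, hA]) T ⟨hT, le_rfl⟩
  · rw [sub_zero, zero_add, NNReal.coe_add, NNReal.coe_one, hGe, dist_eq_norm] at key
    rw [show Φ T (z + h) - Φ T z - A T h = Φ T (z + h) - (Φ T z + A T h) by abel]
    refine key.trans ?_
    have : c = ε * ((M + 1) * (G + 1)) := by rw [hε]; field_simp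
    rw [this]
    have : M * G ≤ (M + 1) * (G + 1) := by gcongr <;> linarith
    calc ε * (M * ‖h‖) * G = ε * (M * G) * ‖h‖ := by ring
      _ ≤ _ := by gcongr
  · have ht' : t ∈ Set.Icc 0 T := ⟨ht.1, ht.2.le⟩
    have hb := hAh t ht'
    have h2 : dist (A t h) 0 < δ := by
      rw [dist_zero_right]
      have := norm_nonneg h
      nlinarith
    have h3 := hδ' h2
    have h4 : v (Φ t z) = v z := by simpa using hinv t 0
    rw [dist_comm, dist_eq_norm, hinv, h4, ← sub_sub]
    exact h3.trans (by gcongr)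

end ODE

/-! ### Rotationally symmetric Hamiltonians without mixed terms -/

/-- A smooth positive `1`-periodic function. -/
structure IsCoefficient (a : ℝ → ℝ) : Prop where
  smooth : ContDiff ℝ ∞ a
  periodic : Function.Periodic a 1
  pos : ∀ s, 0 < a s

namespace IsCoefficient

variable {a : ℝ → ℝ}

theorem hasDerivAt (ha : IsCoefficient a) (s : ℝ) : HasDerivAt a (deriv a s) s :=
  (ha.smooth.differentiable (by simp) s).hasDerivAt

theorem smooth_deriv (ha : IsCoefficient a) : ContDiff ℝ ∞ (deriv a) :=
  (contDiff_infty_iff_deriv.1 ha.smooth).2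

theorem hasDerivAt_deriv (ha : IsCoefficient a) (s : ℝ) :
    HasDerivAt (deriv a) (deriv (deriv a) s) s :=
  (ha.smooth_deriv.differentiable (by simp) s).hasDerivAt

/-- Serves twice: for positive lower bounds of the coefficients, and for the global minimum of `x`
that carries a hyperbolic orbit. -/
theorem exists_forall_le (ha : IsCoefficient a) : ∃ s₀, ∀ s, a s₀ ≤ a s := by
  obtain ⟨s₀, -, h⟩ := (isCompact_Icc (a := (0 : ℝ)) (b := 1)).exists_isMinOn
    ⟨0, by simp⟩ ha.smooth.continuous.continuousOn
  refine ⟨s₀, fun s => ?_⟩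
  obtain ⟨t, ht, hst⟩ := ha.periodic.exists_mem_Ico₀ one_pos s
  rw [hst]
  exact h (Set.Ico_subset_Icc_self ht)

theorem exists_le (ha : IsCoefficient a) : ∃ α, 0 < α ∧ ∀ s, α ≤ a s := by
  obtain ⟨s₀, h⟩ := ha.exists_forall_le
  exact ⟨a s₀, ha.pos s₀, h⟩

end IsCoefficient

theorem periodic_deriv {f : ℝ → ℝ} (hf : Function.Periodic f 1) :
    Function.Periodic (deriv f) 1 := by
  intro s
  rw [← deriv_comp_add_const]
  congr 1
  exact funext hf

/-- The coordinate form `dφ` on `T*ℝ²`. -/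
def dPhi : CotPlane →L[ℝ] ℝ :=
  (ContinuousLinearMap.fst ℝ ℝ ℝ).comp (ContinuousLinearMap.fst ℝ (ℝ × ℝ) (ℝ × ℝ))

/-- The coordinate form `ds` on `T*ℝ²`. -/
def dS : CotPlane →L[ℝ] ℝ :=
  (ContinuousLinearMap.snd ℝ ℝ ℝ).comp (ContinuousLinearMap.fst ℝ (ℝ × ℝ) (ℝ × ℝ))

/-- The coordinate form `dp_φ` on `T*ℝ²`. -/
def dPPhi : CotPlane →L[ℝ] ℝ :=
  (ContinuousLinearMap.fst ℝ ℝ ℝ).comp (ContinuousLinearMap.snd ℝ (ℝ × ℝ) (ℝ × ℝ))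

/-- The coordinate form `dp_s` on `T*ℝ²`. -/
def dPS : CotPlane →L[ℝ] ℝ :=
  (ContinuousLinearMap.snd ℝ ℝ ℝ).comp (ContinuousLinearMap.snd ℝ (ℝ × ℝ) (ℝ × ℝ))

@[simp] theorem dPhi_apply (u : CotPlane) : dPhi u = u.1.1 := rfl
@[simp] theorem dS_apply (u : CotPlane) : dS u = u.1.2 := rfl
@[simp] theorem dPPhi_apply (u : CotPlane) : dPPhi u = u.2.1 := rfl
@[simp] theorem dPS_apply (u : CotPlane) : dPS u = u.2.2 := rfl

/-- The Hamiltonian `½ (a(s) p_φ² + b(s) p_s²)`. -/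
def diagHam (a b : ℝ → ℝ) (z : CotPlane) : ℝ :=
  (a z.1.2 * z.2.1 ^ 2 + b z.1.2 * z.2.2 ^ 2) / 2

/-- The differential of `diagHam`. -/
def diagHamDeriv (a b : ℝ → ℝ) (z : CotPlane) : CotPlane →L[ℝ] ℝ :=
  ((deriv a z.1.2 * z.2.1 ^ 2 + deriv b z.1.2 * z.2.2 ^ 2) / 2) • dS +
    (a z.1.2 * z.2.1) • dPPhi + (b z.1.2 * z.2.2) • dPS

/-- The Hamiltonian vector field of `diagHam`. -/
def diagVec (a b : ℝ → ℝ) (z : CotPlane) : CotPlane :=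
  ((a z.1.2 * z.2.1, b z.1.2 * z.2.2),
    (0, -((deriv a z.1.2 * z.2.1 ^ 2 + deriv b z.1.2 * z.2.2 ^ 2) / 2)))

/-- `diagVec` multiplied by a cutoff function of the Hamiltonian, which is `1` up to the energy
`e` and vanishes from the energy `e + 1` on. -/
def cutVec (a b : ℝ → ℝ) (e : ℝ) (z : CotPlane) : CotPlane :=
  Real.smoothTransition (e + 1 - diagHam a b z) • diagVec a b z

section

variable {a b : ℝ → ℝ}

theorem hasFDerivAt_diagHam (ha : IsCoefficient a) (hb : IsCoefficient b) (z : CotPlane) :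
    HasFDerivAt (diagHam a b) (diagHamDeriv a b z) z := by
  have h1 : HasFDerivAt (fun w : CotPlane => a w.1.2) (deriv a z.1.2 • dS) z :=
    (ha.hasDerivAt z.1.2).comp_hasFDerivAt z dS.hasFDerivAt
  have h2 : HasFDerivAt (fun w : CotPlane => b w.1.2) (deriv b z.1.2 • dS) z :=
    (hb.hasDerivAt z.1.2).comp_hasFDerivAt z dS.hasFDerivAt
  have h3 : HasFDerivAt (fun w : CotPlane => w.2.1) dPPhi z := dPPhi.hasFDerivAt
  have h4 : HasFDerivAt (fun w : CotPlane => w.2.2) dPS z := dPS.hasFDerivAt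
  have := ((h1.mul (h3.pow 2)).add (h2.mul (h4.pow 2))).mul_const (1 / 2)
  refine (this.congr_fderiv ?_).congr_of_eventuallyEq (.of_forall fun w => ?_)
  · ext <;> simp [diagHamDeriv] <;> ring
  · simp [diagHam]; ring

theorem fderiv_diagHam (ha : IsCoefficient a) (hb : IsCoefficient b) :
    fderiv ℝ (diagHam a b) = diagHamDeriv a b :=
  funext fun z => (hasFDerivAt_diagHam ha hb z).fderiv

theorem contDiff_diagHam (ha : IsCoefficient a) (hb : IsCoefficient b) :
    ContDiff ℝ ∞ (diagHam a b) := by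
  have := ha.smooth
  have := hb.smooth
  unfold diagHam
  fun_prop

theorem contDiff_diagVec (ha : IsCoefficient a) (hb : IsCoefficient b) :
    ContDiff ℝ ∞ (diagVec a b) := by
  have := ha.smooth
  have := hb.smooth
  have := ha.smooth_deriv
  have := hb.smooth_deriv
  unfold diagVec
  fun_prop

theorem contDiff_cutVec (ha : IsCoefficient a) (hb : IsCoefficient b) (e : ℝ) :
    ContDiff ℝ ∞ (cutVec a b e) :=
  (Real.smoothTransition.contDiff.comp (contDiff_const.sub (contDiff_diagHam ha hb))).smul
    (contDiff_diagVec ha hb)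

theorem diagHamDeriv_diagVec (z : CotPlane) : diagHamDeriv a b z (diagVec a b z) = 0 := by
  simp [diagHamDeriv, diagVec]
  ring

/-! ### Translation invariance, cutoff and completeness -/

theorem diagHam_add (ha : IsCoefficient a) (hb : IsCoefficient b) (z : CotPlane) (c : ℝ) (n : ℤ) :
    diagHam a b (z + ((c, (n : ℝ)), (0 : ℝ × ℝ))) = diagHam a b z := by
  have h1 : a (z.1.2 + n) = a z.1.2 := by simpa using ha.periodic.int_mul n z.1.2
  have h2 : b (z.1.2 + n) = b z.1.2 := by simpa using hb.periodic.int_mul n z.1.2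
  simp [diagHam, h1, h2]

theorem diagVec_add (ha : IsCoefficient a) (hb : IsCoefficient b) (z : CotPlane) (c : ℝ) (n : ℤ) :
    diagVec a b (z + ((c, (n : ℝ)), (0 : ℝ × ℝ))) = diagVec a b z := by
  have h1 : a (z.1.2 + n) = a z.1.2 := by simpa using ha.periodic.int_mul n z.1.2
  have h2 : b (z.1.2 + n) = b z.1.2 := by simpa using hb.periodic.int_mul n z.1.2
  have h3 : deriv a (z.1.2 + n) = deriv a z.1.2 := by
    simpa using (periodic_deriv ha.periodic).int_mul n z.1.2
  have h4 : deriv b (z.1.2 + n) = deriv b z.1.2 := by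
    simpa using (periodic_deriv hb.periodic).int_mul n z.1.2
  simp [diagVec, h1, h2, h3, h4]

theorem cutVec_add (ha : IsCoefficient a) (hb : IsCoefficient b) (e : ℝ) (z : CotPlane) (c : ℝ)
    (n : ℤ) : cutVec a b e (z + ((c, (n : ℝ)), (0 : ℝ × ℝ))) = cutVec a b e z := by
  rw [cutVec, diagHam_add ha hb, diagVec_add ha hb, cutVec]

theorem cutVec_eq_diagVec {e : ℝ} {z : CotPlane} (hz : diagHam a b z ≤ e) :
    cutVec a b e z = diagVec a b z := by
  rw [cutVec, Real.smoothTransition.one_of_one_le (by linarith), one_smul]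

theorem cutVec_eq_zero {e : ℝ} {z : CotPlane} (hz : e + 1 < diagHam a b z) :
    cutVec a b e z = 0 := by
  rw [cutVec, Real.smoothTransition.zero_of_nonpos (by linarith), zero_smul]

/-- The momenta are bounded on sublevel sets of the Hamiltonian. -/
theorem exists_norm_le_of_diagHam_le (ha : IsCoefficient a) (hb : IsCoefficient b) (e : ℝ) :
    ∃ R, ∀ z, diagHam a b z ≤ e → ‖z.2‖ ≤ R := by
  obtain ⟨α, hα, h1⟩ := ha.exists_le
  obtain ⟨β, hβ, h2⟩ := hb.exists_le
  refine ⟨max (Real.sqrt (2 * e / α)) (Real.sqrt (2 * e / β)), fun z hz => ?_⟩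
  rw [Prod.norm_def]
  have h3 := mul_le_mul_of_nonneg_right (h1 z.1.2) (sq_nonneg z.2.1)
  have h4 := mul_le_mul_of_nonneg_right (h2 z.1.2) (sq_nonneg z.2.2)
  have h5 := mul_nonneg hα.le (sq_nonneg z.2.1)
  have h6 := mul_nonneg hβ.le (sq_nonneg z.2.2)
  unfold diagHam at hz
  refine max_le_max ?_ ?_
  · refine Real.abs_le_sqrt ?_
    rw [le_div_iff₀ hα]
    linarith
  · refine Real.abs_le_sqrt ?_
    rw [le_div_iff₀ hβ]
    linarith

/-- A continuous map on `T*ℝ²` that is invariant under rotations and integral translations and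
vanishes at large energies is bounded. -/
theorem exists_bound_of_invariant {F : Type*} [NormedAddCommGroup F] (ha : IsCoefficient a)
    (hb : IsCoefficient b) {f : CotPlane → F} (hf : Continuous f)
    (hinv : ∀ z (c : ℝ) (n : ℤ), f (z + ((c, (n : ℝ)), (0 : ℝ × ℝ))) = f z)
    {e : ℝ}
    (h0 : ∀ z, e < diagHam a b z → f z = 0) : ∃ C : NNReal, ∀ z, ‖f z‖ ≤ C := by
  obtain ⟨R, hR⟩ := exists_norm_le_of_diagHam_le ha hb e
  -- A rotation brings φ to 0, an integral translation brings s into `[0, 1]`, and the energy bounds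
  -- the momenta: a compact set suffices.
  obtain ⟨C, hC⟩ := (((isCompact_singleton (x := (0 : ℝ))).prod
    (isCompact_Icc (a := (0 : ℝ)) (b := 1))).prod
      (isCompact_closedBall (0 : ℝ × ℝ) R)).exists_bound_of_continuousOn hf.continuousOn
  refine ⟨C.toNNReal, fun z => ?_⟩
  by_cases hz : e < diagHam a b z
  · simp [h0 z hz]
  refine le_trans ?_ (Real.le_coe_toNNReal C)
  have h1 : z + ((-z.1.1, ((-⌊z.1.2⌋ : ℤ) : ℝ)), 0) = ((0, Int.fract z.1.2), z.2) := by
    ext <;> simp [Int.fract, sub_eq_add_neg]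
  rw [← hinv z (-z.1.1) (-⌊z.1.2⌋), h1]
  refine hC _ ⟨⟨rfl, Int.fract_nonneg _, (Int.fract_lt_one _).le⟩, ?_⟩
  simpa using hR z (not_lt.1 hz)

theorem exists_norm_cutVec_le (ha : IsCoefficient a) (hb : IsCoefficient b) (e : ℝ) :
    ∃ C : NNReal, ∀ z, ‖cutVec a b e z‖ ≤ C :=
  exists_bound_of_invariant ha hb (contDiff_cutVec ha hb e).continuous (cutVec_add ha hb e)
    fun _ hz => cutVec_eq_zero hz

/-- The derivative inherits the invariance and the vanishing at high energy, so it is bounded, and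
the mean value inequality applies. -/
theorem exists_lipschitzWith_cutVec (ha : IsCoefficient a) (hb : IsCoefficient b) (e : ℝ) :
    ∃ K, LipschitzWith K (cutVec a b e) := by
  have hs := contDiff_cutVec ha hb e
  have hinv : ∀ z (c : ℝ) (n : ℤ), fderiv ℝ (cutVec a b e) (z + ((c, (n : ℝ)), (0 : ℝ × ℝ))) =
      fderiv ℝ (cutVec a b e) z := fun z c n => by
    rw [← fderiv_comp_add_right]
    congr 1
    exact funext fun w => cutVec_add ha hb e w c n
  have h0 : ∀ z, e + 1 < diagHam a b z → fderiv ℝ (cutVec a b e) z = 0 := fun z hz => by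
    have : cutVec a b e =ᶠ[nhds z] fun _ => 0 := by
      filter_upwards [(contDiff_diagHam ha hb).continuous.continuousAt.eventually
        (eventually_gt_nhds hz)] with w hw
      exact cutVec_eq_zero hw
    rw [this.fderiv_eq]
    simp
  obtain ⟨K, hK⟩ := exists_bound_of_invariant ha hb (hs.continuous_fderiv (by simp)) hinv h0
  exact ⟨K, lipschitzWith_of_nnnorm_fderiv_le (hs.differentiable (by simp)) hK⟩

/-- The Hamiltonian is constant along the integral curves of multiples of the Hamiltonian vector
field. -/
theorem diagHam_eq_of_hasDerivAt (ha : IsCoefficient a) (hb : IsCoefficient b) {γ : ℝ → CotPlane}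
    {c : ℝ → ℝ} (hγ : ∀ t, HasDerivAt γ (c t • diagVec a b (γ t)) t) (t : ℝ) :
    diagHam a b (γ t) = diagHam a b (γ 0) := by
  have h : ∀ τ, HasDerivAt (fun τ => diagHam a b (γ τ)) 0 τ := fun τ => by
    have := (hasFDerivAt_diagHam ha hb (γ τ)).comp_hasDerivAt τ (hγ τ)
    rwa [map_smul, diagHamDeriv_diagVec, smul_zero] at this
  exact is_const_of_deriv_eq_zero (fun τ => (h τ).differentiableAt) (fun τ => (h τ).deriv) t 0

/-- By conservation of energy the curve never leaves the region where the cutoff is 1. This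
transfers Lipschitz results to the uncut field. -/
theorem hasDerivAt_cutVec_of_diagVec (ha : IsCoefficient a) (hb : IsCoefficient b) {e : ℝ}
    {γ : ℝ → CotPlane} (hγ : ∀ t, HasDerivAt γ (diagVec a b (γ t)) t)
    (h0 : diagHam a b (γ 0) ≤ e) (t : ℝ) : HasDerivAt γ (cutVec a b e (γ t)) t := by
  rw [cutVec_eq_diagVec]
  · exact hγ t
  · rwa [diagHam_eq_of_hasDerivAt ha hb (c := fun _ => 1) (by simpa using hγ)]

/-- The Hamiltonian vector field is complete. -/
theorem exists_hasDerivAt_diagVec (ha : IsCoefficient a) (hb : IsCoefficient b) (z : CotPlane) :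
    ∃ γ : ℝ → CotPlane, γ 0 = z ∧ ∀ t, HasDerivAt γ (diagVec a b (γ t)) t := by
  -- The cutoff is placed at the energy of `z`; the cut field is a multiple of the Hamiltonian one,
  -- so its orbit keeps that energy and solves the original equation.
  obtain ⟨K, hK⟩ := exists_lipschitzWith_cutVec ha hb (diagHam a b z)
  obtain ⟨B, hB⟩ := exists_norm_cutVec_le ha hb (diagHam a b z)
  obtain ⟨γ, h0, hγ⟩ := exists_hasDerivAt_of_lipschitzWith hK hB z
  refine ⟨γ, h0, fun t => ?_⟩
  rw [← cutVec_eq_diagVec (e := diagHam a b z)]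
  · exact hγ t
  · rw [diagHam_eq_of_hasDerivAt ha hb hγ, h0]

theorem eq_of_hasDerivAt_diagVec (ha : IsCoefficient a) (hb : IsCoefficient b)
    {γ γ' : ℝ → CotPlane} (hγ : ∀ t, HasDerivAt γ (diagVec a b (γ t)) t)
    (hγ' : ∀ t, HasDerivAt γ' (diagVec a b (γ' t)) t) (h : γ 0 = γ' 0) : γ = γ' := by
  obtain ⟨K, hK⟩ := exists_lipschitzWith_cutVec ha hb (diagHam a b (γ 0))
  exact ODE_solution_unique_univ (v := fun _ => cutVec a b (diagHam a b (γ 0)))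
    (s := fun _ => Set.univ) (t₀ := 0) (fun _ => hK.lipschitzOnWith)
    (fun t => ⟨hasDerivAt_cutVec_of_diagVec ha hb hγ le_rfl t, trivial⟩)
    (fun t => ⟨hasDerivAt_cutVec_of_diagVec ha hb hγ' (by rw [h]) t, trivial⟩) h

/-- The derivative of `diagVec` at a point with `a'(s) = 0` and `p_s = 0`. -/
def parallelLin (a b : ℝ → ℝ) (z : CotPlane) : CotPlane →L[ℝ] CotPlane :=
  ((a z.1.2 • dPPhi).prod (b z.1.2 • dPS)).prod
    ((0 : CotPlane →L[ℝ] ℝ).prod ((-(deriv (deriv a) z.1.2 * z.2.1 ^ 2 / 2)) • dS))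

/-- Every other first-order term carries a factor `a'(s)` or `p_s`. -/
theorem hasFDerivAt_diagVec (ha : IsCoefficient a) (hb : IsCoefficient b) {z : CotPlane}
    (h1 : deriv a z.1.2 = 0) (h2 : z.2.2 = 0) :
    HasFDerivAt (diagVec a b) (parallelLin a b z) z := by
  have ha0 : HasFDerivAt (fun w : CotPlane => a w.1.2) (deriv a z.1.2 • dS) z :=
    (ha.hasDerivAt z.1.2).comp_hasFDerivAt z dS.hasFDerivAt
  have hb0 : HasFDerivAt (fun w : CotPlane => b w.1.2) (deriv b z.1.2 • dS) z :=
    (hb.hasDerivAt z.1.2).comp_hasFDerivAt z dS.hasFDerivAt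
  have ha1 : HasFDerivAt (fun w : CotPlane => deriv a w.1.2) (deriv (deriv a) z.1.2 • dS) z :=
    HasDerivAt.comp_hasFDerivAt (h₂ := deriv a) z (ha.hasDerivAt_deriv z.1.2) dS.hasFDerivAt
  have hb1 : HasFDerivAt (fun w : CotPlane => deriv b w.1.2) (deriv (deriv b) z.1.2 • dS) z :=
    HasDerivAt.comp_hasFDerivAt (h₂ := deriv b) z (hb.hasDerivAt_deriv z.1.2) dS.hasFDerivAt
  have h3 : HasFDerivAt (fun w : CotPlane => w.2.1) dPPhi z := dPPhi.hasFDerivAt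
  have h4 : HasFDerivAt (fun w : CotPlane => w.2.2) dPS z := dPS.hasFDerivAt
  have := ((ha0.mul h3).prodMk (hb0.mul h4)).prodMk ((hasFDerivAt_const (0 : ℝ) z).prodMk
    (((ha1.mul (h3.pow 2)).add (hb1.mul (h4.pow 2))).mul_const (-(1 / 2))))
  refine (this.congr_fderiv ?_).congr_of_eventuallyEq (.of_forall fun w => ?_)
  · ext <;> simp [parallelLin, h1, h2]
    ring
  · simp [diagVec]; ring

/-- dH is the symplectic pairing with the Hamiltonian field, dH = φ' dp_φ + s' dp_s - p_s' ds, so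
the Hessian of H can be read off from the linearized field. -/
theorem hasFDerivAt_diagHamDeriv_apply (ha : IsCoefficient a) (hb : IsCoefficient b) {z : CotPlane}
    (h1 : deriv a z.1.2 = 0) (h2 : z.2.2 = 0) (v : CotPlane) :
    HasFDerivAt (fun w => diagHamDeriv a b w v)
      ((deriv (deriv a) z.1.2 * z.2.1 ^ 2 / 2 * v.1.2) • dS + (a z.1.2 * v.2.1) • dPPhi +
        (b z.1.2 * v.2.2) • dPS) z := by
  have h := hasFDerivAt_diagVec ha hb h1 h2
  have h3 := (((dPhi.hasFDerivAt.comp z h).mul_const v.2.1).add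
    ((dS.hasFDerivAt.comp z h).mul_const v.2.2)).sub ((dPS.hasFDerivAt.comp z h).mul_const v.1.2)
  refine (h3.congr_fderiv ?_).congr_of_eventuallyEq (.of_forall fun w => ?_)
  · ext <;> simp [parallelLin] <;> ring
  · simp [diagHamDeriv, diagVec]; ring

/-- The second derivative of the Hamiltonian at a point with `a'(s) = 0` and `p_s = 0`. -/
theorem fderiv_fderiv_diagHam (ha : IsCoefficient a) (hb : IsCoefficient b) {z : CotPlane}
    (h1 : deriv a z.1.2 = 0) (h2 : z.2.2 = 0) (u v : CotPlane) :
    fderiv ℝ (fderiv ℝ (diagHam a b)) z u v =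
      deriv (deriv a) z.1.2 * z.2.1 ^ 2 / 2 * v.1.2 * u.1.2 + a z.1.2 * v.2.1 * u.2.1 +
        b z.1.2 * v.2.2 * u.2.2 := by
  have hd : DifferentiableAt ℝ (fderiv ℝ (diagHam a b)) z :=
    ((contDiff_diagHam ha hb).fderiv_right (m := ∞) (by simp)).differentiable (by simp) z
  have h3 : HasFDerivAt (fun w => fderiv ℝ (diagHam a b) w v)
      ((fderiv ℝ (fderiv ℝ (diagHam a b)) z).flip v) z := by
    simpa using hd.hasFDerivAt.clm_apply (hasFDerivAt_const v z)
  have h4 := hasFDerivAt_diagHamDeriv_apply ha hb h1 h2 v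
  rw [← fderiv_diagHam ha hb] at h4
  have := congrArg (fun l => l u) (h3.unique h4)
  simpa using this

end

/-! ### The Clairaut integral of a rotationally symmetric Hamiltonian -/

section

variable {a b : ℝ → ℝ} {H : CotTorus → ℝ}

theorem continuous_cotProj : Continuous cotProj := by
  have : Continuous ((↑) : ℝ → UnitAddCircle) := AddCircle.continuous_mk' 1
  unfold cotProj
  fun_prop

theorem cotProj_surjective : Function.Surjective cotProj := by
  rintro ⟨⟨p, q⟩, r⟩
  obtain ⟨p, rfl⟩ := QuotientAddGroup.mk_surjective p
  obtain ⟨q, rfl⟩ := QuotientAddGroup.mk_surjective q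
  exact ⟨((p, q), r), rfl⟩

theorem coe_eq_coe_iff_exists_int {s t : ℝ} :
    (s : UnitAddCircle) = t ↔ ∃ n : ℤ, s = t + n := by
  rw [← sub_eq_zero, ← AddCircle.coe_sub, AddCircle.coe_eq_zero_iff]
  refine exists_congr fun n => ?_
  rw [zsmul_one]
  constructor <;> intro h <;> linarith

theorem apply_eq_of_coe_eq {f : ℝ → ℝ} (hf : Function.Periodic f 1) {s t : ℝ}
    (h : (s : UnitAddCircle) = t) : f s = f t := by
  obtain ⟨n, rfl⟩ := coe_eq_coe_iff_exists_int.1 h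
  simpa using hf.int_mul n t

theorem apply_cotProj_eq (hH : H ∘ cotProj = diagHam a b) (z : CotPlane) :
    H (cotProj z) = diagHam a b z := congrFun hH z

theorem hamVec_eq_diagVec (ha : IsCoefficient a) (hb : IsCoefficient b)
    (hH : H ∘ cotProj = diagHam a b) : hamVec H = diagVec a b := by
  funext z
  simp [hamVec, hH, fderiv_diagHam ha hb, diagHamDeriv, diagVec]

theorem mem_levelTangent (ha : IsCoefficient a) (hb : IsCoefficient b)
    (hH : H ∘ cotProj = diagHam a b) {z u : CotPlane} :
    u ∈ levelTangent H z ↔ diagHamDeriv a b z u = 0 := by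
  simp [levelTangent, hH, fderiv_diagHam ha hb]

/-- The Hamiltonian flow exists. -/
theorem exists_isHamiltonianFlow (ha : IsCoefficient a) (hb : IsCoefficient b)
    (hH : H ∘ cotProj = diagHam a b) : ∃ Φ φ, IsHamiltonianFlow H Φ φ := by
  choose γ h0 hγ using exists_hasDerivAt_diagVec ha hb
  have hlift := Function.rightInverse_surjInv cotProj_surjective
  refine ⟨fun t z => γ z t, fun t z => cotProj (γ (Function.surjInv cotProj_surjective z) t),
    h0, fun t z => ?_, fun t z => ?_⟩
  · rw [hamVec_eq_diagVec ha hb hH]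
    exact hγ z t
  -- The projected flow uses a chosen lift. Any other lift differs by an integral translation, which
  -- carries orbits to orbits, so uniqueness makes the choice immaterial.
  · set w := Function.surjInv cotProj_surjective (cotProj z) with hw
    have hwz : cotProj w = cotProj z := hlift _
    simp only [cotProj, Prod.mk.injEq] at hwz
    obtain ⟨⟨h1, h2⟩, h3⟩ := hwz
    obtain ⟨m, hm⟩ := coe_eq_coe_iff_exists_int.1 h1
    obtain ⟨n, hn⟩ := coe_eq_coe_iff_exists_int.1 h2
    have hz : w = z + (((m : ℝ), (n : ℝ)), (0 : ℝ × ℝ)) := by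
      ext <;> simp [hm, hn, h3]
    have key : γ w = fun t => γ z t + (((m : ℝ), (n : ℝ)), (0 : ℝ × ℝ)) := by
      refine eq_of_hasDerivAt_diagVec ha hb (hγ w) (fun t => ?_) (by simp [h0, hz])
      rw [diagVec_add ha hb]
      exact (hγ z t).add_const _
    have hshift : ∀ (q : ℝ) (k : ℤ), ((q + k : ℝ) : UnitAddCircle) = q := fun q k =>
      coe_eq_coe_iff_exists_int.2 ⟨k, rfl⟩
    simp only [key, cotProj, Prod.fst_add, Prod.snd_add, add_zero, hshift]

theorem isCompact_energyLevel (ha : IsCoefficient a) (hb : IsCoefficient b)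
    (hH : H ∘ cotProj = diagHam a b) (e : ℝ) : IsCompact (energyLevel H e) := by
  obtain ⟨R, hR⟩ := exists_norm_le_of_diagHam_le ha hb e
  have hc : IsCompact (((Set.Icc (0 : ℝ) 1 ×ˢ Set.Icc (0 : ℝ) 1) ×ˢ
      Metric.closedBall (0 : ℝ × ℝ) R) ∩ {z | diagHam a b z = e}) :=
    ((isCompact_Icc.prod isCompact_Icc).prod (isCompact_closedBall _ _)).inter_right
      (isClosed_eq (contDiff_diagHam ha hb).continuous continuous_const)
  convert hc.image continuous_cotProj using 1
  ext z
  constructor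
  · intro hz
    obtain ⟨w, rfl⟩ := cotProj_surjective z
    have hw : cotProj ((Int.fract w.1.1, Int.fract w.1.2), w.2) = cotProj w := by
      have : ∀ q : ℝ, ((Int.fract q : ℝ) : UnitAddCircle) = q := fun q =>
        coe_eq_coe_iff_exists_int.2 ⟨-⌊q⌋, by simp [Int.fract, sub_eq_add_neg]⟩
      simp [cotProj, this]
    have he : diagHam a b ((Int.fract w.1.1, Int.fract w.1.2), w.2) = e := by
      rw [← apply_cotProj_eq hH, hw]
      exact hz
    refine ⟨_, ⟨⟨⟨⟨Int.fract_nonneg _, (Int.fract_lt_one _).le⟩,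
      ⟨Int.fract_nonneg _, (Int.fract_lt_one _).le⟩⟩, ?_⟩, he⟩, hw⟩
    simpa using hR _ he.le
  · rintro ⟨w, ⟨-, hw⟩, rfl⟩
    exact (apply_cotProj_eq hH w).trans hw

theorem fderiv_clairaut (z : CotPlane) : fderiv ℝ (clairaut ∘ cotProj) z = dPPhi :=
  dPPhi.hasFDerivAt.fderiv

theorem momentum_ne_zero_of_diagHam_eq {e : ℝ} (he : 0 < e) {z : CotPlane}
    (hz : diagHam a b z = e) (h2 : z.2.2 = 0) : z.2.1 ≠ 0 := by
  intro h4
  simp [diagHam, h2, h4] at hz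
  exact he.ne hz

/-- The critical points of the Clairaut integral on a positive energy level. -/
theorem mem_critLift_clairaut (ha : IsCoefficient a) (hb : IsCoefficient b)
    (hH : H ∘ cotProj = diagHam a b) {e : ℝ} (he : 0 < e) {z : CotPlane} :
    z ∈ critLift H clairaut e ↔ diagHam a b z = e ∧ deriv a z.1.2 = 0 ∧ z.2.2 = 0 := by
  have ha0 := ha.pos z.1.2
  have hb0 := hb.pos z.1.2
  simp only [critLift, energyLevel, Set.mem_ofPred_eq, apply_cotProj_eq hH,
    mem_levelTangent ha hb hH, fderiv_clairaut, dPPhi_apply]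
  refine and_congr_right fun hz => ⟨fun h => ?_, ?_⟩
  -- Two vectors of ker dH suffice: one in the momentum plane, whose dp_φ is b p_s, and one in the
  -- (s, p_φ) plane, whose dp_φ is -∂H/∂s.
  · have h1 := h ((0, 0), (b z.1.2 * z.2.2, -(a z.1.2 * z.2.1))) (by simp [diagHamDeriv]; ring)
    have h2 : z.2.2 = 0 := by simpa [hb0.ne'] using h1
    have h3 := h ((0, a z.1.2 * z.2.1),
      (-((deriv a z.1.2 * z.2.1 ^ 2 + deriv b z.1.2 * z.2.2 ^ 2) / 2), 0))
      (by simp [diagHamDeriv]; ring)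
    have h4 := momentum_ne_zero_of_diagHam_eq he hz h2
    refine ⟨?_, h2⟩
    simpa [h2, h4] using h3
  · rintro ⟨h1, h2⟩ u hu
    have h4 := momentum_ne_zero_of_diagHam_eq he hz h2
    simpa [diagHamDeriv, h1, h2, h4, ha0.ne'] using hu

/-- A smooth map whose zero set near the critical points is the critical set. -/
def critMap (a b : ℝ → ℝ) (e : ℝ) (z : CotPlane) : EuclideanSpace ℝ (Fin 3) :=
  !₂[deriv a z.1.2, diagHam a b z - e, z.2.2]

theorem contDiff_critMap (ha : IsCoefficient a) (hb : IsCoefficient b) (e : ℝ) :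
    ContDiff ℝ ∞ (critMap a b e) := by
  have h1 := ha.smooth_deriv
  have h2 := contDiff_diagHam ha hb
  rw [contDiff_euclidean]
  intro i
  fin_cases i
  · exact h1.comp (contDiff_snd.comp contDiff_fst)
  · exact h2.sub contDiff_const
  · exact contDiff_snd.comp contDiff_snd

/-- At a critical point dH reduces to a p_φ dp_φ, so the three components have differentials
proportional to ds, dp_φ, dp_s; the Morse condition then yields a submersion. -/
theorem fderiv_critMap (ha : IsCoefficient a) (hb : IsCoefficient b) {e : ℝ} {z : CotPlane}
    (h1 : deriv a z.1.2 = 0) (h2 : z.2.2 = 0) (u : CotPlane) :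
    fderiv ℝ (critMap a b e) z u =
      !₂[deriv (deriv a) z.1.2 * u.1.2, a z.1.2 * z.2.1 * u.2.1, u.2.2] := by
  have hd : ∀ i : Fin 3, HasFDerivAt (fun w => critMap a b e w i)
      ((EuclideanSpace.proj i).comp (fderiv ℝ (critMap a b e) z)) z := fun i =>
    (EuclideanSpace.proj (𝕜 := ℝ) i).hasFDerivAt.comp z
      ((contDiff_critMap ha hb e).differentiable (by simp) z).hasFDerivAt
  have e0 : HasFDerivAt (fun w : CotPlane => deriv a w.1.2) (deriv (deriv a) z.1.2 • dS) z :=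
    HasDerivAt.comp_hasFDerivAt (h₂ := deriv a) z (ha.hasDerivAt_deriv z.1.2) dS.hasFDerivAt
  have e1 := (hasFDerivAt_diagHam ha hb z).sub_const e
  have e2 : HasFDerivAt (fun w : CotPlane => w.2.2) dPS z := dPS.hasFDerivAt
  have d0 := congrArg (fun l => l u) ((hd 0).unique (by simpa [critMap] using e0))
  have d1 := congrArg (fun l => l u) ((hd 1).unique (by simpa [critMap] using e1))
  have d2 := congrArg (fun l => l u) ((hd 2).unique (by simpa [critMap] using e2))
  ext i
  fin_cases i
  · simpa using d0
  · simpa [diagHamDeriv, h1, h2] using d1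
  · simpa using d2

/-- The critical points of the Clairaut integral on a positive energy level form a submanifold
whose tangent space is the line of rotations. -/
theorem isSubmanifoldAt_critLift (ha : IsCoefficient a) (hb : IsCoefficient b)
    (hH : H ∘ cotProj = diagHam a b) {e : ℝ} (he : 0 < e)
    (hm : ∀ s, deriv a s = 0 → deriv (deriv a) s ≠ 0) {z : CotPlane}
    (hz : z ∈ critLift H clairaut e) :
    IsSubmanifoldAt (critLift H clairaut e) z
      (LinearMap.ker ((dS.prod (dPPhi.prod dPS) : CotPlane →L[ℝ] ℝ × ℝ × ℝ) :
        CotPlane →ₗ[ℝ] ℝ × ℝ × ℝ)) := by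
  obtain ⟨h0, h1, h2⟩ := (mem_critLift_clairaut ha hb hH he).1 hz
  have h3 := momentum_ne_zero_of_diagHam_eq he h0 h2
  have h4 := hm _ h1
  have h5 := (ha.pos z.1.2).ne'
  refine ⟨3, critMap a b e, Set.univ, isOpen_univ, trivial, (contDiff_critMap ha hb e).contDiffOn,
    ?_, fun w => ?_, ?_⟩
  · ext w
    simp only [Set.inter_univ, Set.mem_univ, true_and, Set.mem_ofPred_eq,
      mem_critLift_clairaut ha hb hH he, critMap]
    constructor
    · rintro ⟨g0, g1, g2⟩
      ext i
      fin_cases i <;> simp [g0, g1, g2]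
    · intro g
      have g0 := congrArg (fun v => v 0) g
      have g1 := congrArg (fun v => v 1) g
      have g2 := congrArg (fun v => v 2) g
      simp only [Matrix.cons_val, PiLp.zero_apply] at g0 g1 g2
      exact ⟨by linarith, g0, g2⟩
  · refine ⟨((0, w 0 / deriv (deriv a) z.1.2), (w 1 / (a z.1.2 * z.2.1), w 2)), ?_⟩
    rw [fderiv_critMap ha hb h1 h2]
    ext i
    fin_cases i
    · simp [mul_div_cancel₀, h4]
    · simp [mul_div_cancel₀, h3, h5]
    · simp
  · ext u
    simp only [LinearMap.mem_ker, ContinuousLinearMap.coe_coe, fderiv_critMap ha hb h1 h2,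
      ContinuousLinearMap.prod_apply, dS_apply, dPPhi_apply, dPS_apply, Prod.mk_eq_zero]
    constructor
    · rintro ⟨g0, g1, g2⟩
      ext i
      fin_cases i <;> simp [g0, g1, g2]
    · intro g
      have g0 := congrArg (fun v => v 0) g
      have g1 := congrArg (fun v => v 1) g
      have g2 := congrArg (fun v => v 2) g
      simp only [Matrix.cons_val, PiLp.zero_apply] at g0 g1 g2
      exact ⟨by simpa [h4] using g0, by simpa [h3, h5] using g1, g2⟩

theorem clairaut_flow_eq (ha : IsCoefficient a) (hb : IsCoefficient b)
    (hH : H ∘ cotProj = diagHam a b) {Φ : ℝ → CotPlane → CotPlane}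
    {φ : ℝ → CotTorus → CotTorus} (hφ : IsHamiltonianFlow H Φ φ) (t : ℝ) (z : CotTorus) :
    clairaut (φ t z) = clairaut z := by
  obtain ⟨w, rfl⟩ := cotProj_surjective z
  have h : ∀ τ, HasDerivAt (fun τ => (Φ τ w).2.1) 0 τ := fun τ => by
    have := dPPhi.hasFDerivAt.comp_hasDerivAt τ (hφ.hasDerivAt τ w)
    simpa [hamVec_eq_diagVec ha hb hH, diagVec, Function.comp_def] using this
  have := is_const_of_deriv_eq_zero (fun τ => (h τ).differentiableAt) (fun τ => (h τ).deriv) t 0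
  rw [hφ.proj]
  simpa [clairaut, cotProj, hφ.zero] using this

theorem isBottSystem_clairaut (ha : IsCoefficient a) (hb : IsCoefficient b)
    (hH : H ∘ cotProj = diagHam a b) {e : ℝ} (he : 0 < e)
    (hm : ∀ s, deriv a s = 0 → deriv (deriv a) s ≠ 0) {Φ : ℝ → CotPlane → CotPlane}
    {φ : ℝ → CotTorus → CotTorus} (hφ : IsHamiltonianFlow H Φ φ) :
    IsBottSystem H clairaut e φ where
  smooth_H := hH ▸ contDiff_diagHam ha hb
  smooth_f := dPPhi.contDiff
  isCompact := isCompact_energyLevel ha hb hH e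
  regular z hz h := by
    -- Euler's identity: H is quadratic in the momenta, so dH on the radial vector is 2H = 2e, which
    -- is not 0.
    have h1 : diagHamDeriv a b z (0, z.2) = 0 := by
      rw [← fderiv_diagHam ha hb, ← hH, h]
      rfl
    have h2 : diagHam a b z = e := (apply_cotProj_eq hH z).symm.trans hz
    simp only [diagHamDeriv, add_apply, smul_apply, dS_apply, dPPhi_apply, dPS_apply,
      smul_eq_mul, Prod.snd_zero, mul_zero, zero_add] at h1
    unfold diagHam at h2
    nlinarith
  firstIntegral := clairaut_flow_eq ha hb hH hφ
  bott z hz := by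
    obtain ⟨h0, h1, h2⟩ := (mem_critLift_clairaut ha hb hH he).1 hz
    have h3 := momentum_ne_zero_of_diagHam_eq he h0 h2
    have h4 := hm _ h1
    have h5 := (ha.pos z.1.2).ne'
    have h6 := (hb.pos z.1.2).ne'
    have hT : ∀ u : CotPlane, u ∈ levelTangent H z ↔ u.2.1 = 0 := fun u => by
      simp [mem_levelTangent ha hb hH, diagHamDeriv, h1, h2, h3, h5]
    refine ⟨_, isSubmanifoldAt_critLift ha hb hH he hm hz, ?_, ?_⟩
    · refine lt_of_le_of_ne (fun u hu => ?_) fun h => ?_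
      · simp only [LinearMap.mem_ker, ContinuousLinearMap.coe_coe,
          ContinuousLinearMap.prod_apply, dS_apply, dPPhi_apply, dPS_apply,
          Prod.mk_eq_zero] at hu
        exact (hT u).2 hu.2.1
      · have := (hT ((0, 1), (0, 0))).2 rfl
        rw [← h] at this
        simp at this
    -- The Lagrange multiplier, since dH = a p_φ dp_φ here. As p_φ is linear, only -c D²H remains;
    -- pairing with ∂_s and ∂_{p_s} kills those two components of `u`.
    · refine ⟨(a z.1.2 * z.2.1)⁻¹, ?_, fun u hu hv => ?_⟩
      · rw [fderiv_clairaut, hH, fderiv_diagHam ha hb]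
        ext <;> simp [diagHamDeriv, h1, h2]
        field_simp
      · have hc : fderiv ℝ (fderiv ℝ (clairaut ∘ cotProj)) z = 0 := by
          rw [show fderiv ℝ (clairaut ∘ cotProj) = fun _ => dPPhi from funext fderiv_clairaut]
          simp
        have hv1 := hv ((0, 1), (0, 0)) ((hT _).2 rfl)
        have hv2 := hv ((0, 0), (0, 1)) ((hT _).2 rfl)
        rw [hc, hH, fderiv_fderiv_diagHam ha hb h1 h2] at hv1 hv2
        simp only [LinearMap.mem_ker, ContinuousLinearMap.coe_coe,
          ContinuousLinearMap.prod_apply, dS_apply, dPPhi_apply, dPS_apply, Prod.mk_eq_zero]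
        exact ⟨by simpa [h3, h4, h5] using hv1, (hT u).1 hu, by simpa [h3, h5, h6] using hv2⟩

/-! ### The closed orbits over the parallels -/

/-- The circle of the covectors `(p_φ, p_s) = (c, 0)` over the parallel of `s`. -/
def momentumCircle (s c : ℝ) : Set CotTorus :=
  Set.range fun φ : UnitAddCircle => (((φ, (s : UnitAddCircle)), (c, 0)) : CotTorus)

theorem cotProj_mem_momentumCircle {s c : ℝ} {z : CotPlane} :
    cotProj z ∈ momentumCircle s c ↔ (z.1.2 : UnitAddCircle) = s ∧ z.2 = (c, 0) := by
  constructor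
  · rintro ⟨φ, h⟩
    simp only [cotProj, Prod.mk.injEq] at h
    exact ⟨h.1.2.symm, h.2.symm⟩
  · rintro ⟨h1, h2⟩
    exact ⟨z.1.1, by simp [cotProj, h1, h2]⟩

/-- The field at `z` points along ∂_φ and does not change under rotations, so uniform rotation is a
solution; uniqueness does the rest. -/
theorem flow_eq_of_critical (ha : IsCoefficient a) (hb : IsCoefficient b)
    (hH : H ∘ cotProj = diagHam a b) {Φ : ℝ → CotPlane → CotPlane}
    {φ : ℝ → CotTorus → CotTorus} (hφ : IsHamiltonianFlow H Φ φ) {z : CotPlane}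
    (h1 : deriv a z.1.2 = 0) (h2 : z.2.2 = 0) (t : ℝ) :
    Φ t z = z + ((t * (a z.1.2 * z.2.1), 0), (0 : ℝ × ℝ)) := by
  have := eq_of_hasDerivAt_diagVec ha hb (γ := fun τ => Φ τ z)
    (γ' := fun τ => z + ((τ * (a z.1.2 * z.2.1), 0), (0 : ℝ × ℝ)))
    (fun τ => hamVec_eq_diagVec ha hb hH ▸ hφ.hasDerivAt τ z) (fun τ => ?_) (by simp [hφ.zero])
  · exact congrFun this t
  · have h3 : diagVec a b (z + ((τ * (a z.1.2 * z.2.1), 0), (0 : ℝ × ℝ))) =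
        ((1 * (a z.1.2 * z.2.1), 0), (0 : ℝ × ℝ)) := by
      have := diagVec_add ha hb z (τ * (a z.1.2 * z.2.1)) 0
      rw [Int.cast_zero] at this
      rw [this]
      simp [diagVec, h1, h2]
    rw [h3]
    exact ((((hasDerivAt_id τ).mul_const _).prodMk (hasDerivAt_const τ (0 : ℝ))).prodMk
      (hasDerivAt_const τ (0 : ℝ × ℝ))).const_add z

/-- The angle in ℝ/ℤ advances at the constant speed a(s) c, so the first return is after time
1/|a(s) c|. -/
theorem isPeriodicOrbit_momentumCircle (ha : IsCoefficient a) (hb : IsCoefficient b)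
    (hH : H ∘ cotProj = diagHam a b) {Φ : ℝ → CotPlane → CotPlane}
    {φ : ℝ → CotTorus → CotTorus} (hφ : IsHamiltonianFlow H Φ φ) {s c : ℝ} (hs : deriv a s = 0)
    (hc : c ≠ 0) : IsPeriodicOrbit φ (momentumCircle s c) |a s * c|⁻¹ := by
  have hac : a s * c ≠ 0 := mul_ne_zero (ha.pos s).ne' hc
  have hflow : ∀ (t p : ℝ), φ t ((((p : ℝ) : UnitAddCircle), (s : UnitAddCircle)), (c, 0)) =
      ((((p + t * (a s * c) : ℝ) : UnitAddCircle), (s : UnitAddCircle)), (c, 0)) := by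
    intro t p
    have h1 := flow_eq_of_critical ha hb hH hφ (z := ((p, s), (c, 0))) hs rfl t
    have h2 := hφ.proj t ((p, s), (c, 0))
    rw [h1] at h2
    simpa [cotProj] using h2
  have hpos : 0 < |a s * c| := abs_pos.2 hac
  refine ⟨inv_pos.2 hpos, Set.range_nonempty _, ?_⟩
  rintro _ ⟨p, rfl⟩
  obtain ⟨p, rfl⟩ := QuotientAddGroup.mk_surjective p
  refine ⟨?_, fun t ht0 ht1 h => ?_, ?_⟩
  · refine (hflow _ p).trans ?_
    simp only [Prod.mk.injEq, and_true]
    refine coe_eq_coe_iff_exists_int.2 ?_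
    rcases abs_cases (a s * c) with ⟨h, -⟩ | ⟨h, -⟩
    · exact ⟨1, by rw [h, inv_mul_cancel₀ hac]; simp⟩
    · exact ⟨-1, by rw [h, inv_neg, neg_mul, inv_mul_cancel₀ hac]; simp⟩
  · have h' := (hflow t p).symm.trans h
    simp only [Prod.mk.injEq, and_true] at h'
    obtain ⟨n, hn⟩ := coe_eq_coe_iff_exists_int.1 h'
    have h1 : t * (a s * c) = n := by linarith
    have h2 : |t * (a s * c)| < 1 := by
      rw [abs_mul, abs_of_pos ht0]
      calc t * |a s * c| < |a s * c|⁻¹ * |a s * c| := by gcongr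
        _ = 1 := inv_mul_cancel₀ hpos.ne'
    have h3 : n = 0 := by
      rw [h1] at h2
      exact Int.abs_lt_one_iff.1 (by exact_mod_cast h2)
    rw [h3, Int.cast_zero, mul_eq_zero] at h1
    exact h1.elim ht0.ne' hac
  · ext w
    constructor
    · rintro ⟨q, rfl⟩
      obtain ⟨q, rfl⟩ := QuotientAddGroup.mk_surjective q
      refine ⟨(q - p) / (a s * c), (hflow _ p).trans ?_⟩
      rw [div_mul_cancel₀ _ hac, add_sub_cancel]
    · rintro ⟨t, rfl⟩
      exact ⟨_, (hflow t p).symm⟩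

/-- The flow is differentiable along the closed orbits over the critical parallels. -/
theorem hasFDerivAt_flow_of_critical (ha : IsCoefficient a) (hb : IsCoefficient b)
    (hH : H ∘ cotProj = diagHam a b) {Φ : ℝ → CotPlane → CotPlane}
    {φ : ℝ → CotTorus → CotTorus} (hφ : IsHamiltonianFlow H Φ φ) {z : CotPlane}
    (h1 : deriv a z.1.2 = 0) (h2 : z.2.2 = 0) {T : ℝ} (hT : 0 ≤ T) :
    HasFDerivAt (Φ T) (NormedSpace.exp (T • parallelLin a b z) : CotPlane →L[ℝ] CotPlane) z := by
  -- The margin 1 keeps a whole neighbourhood of `z` below the cutoff, so that nearby orbits too are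
  -- orbits of the cut field.
  set e := diagHam a b z + 1 with he
  obtain ⟨K, hK⟩ := exists_lipschitzWith_cutVec ha hb e
  have hev : ∀ᶠ w in nhds z, diagHam a b w < e :=
    (contDiff_diagHam ha hb).continuous.continuousAt.eventually
      (eventually_lt_nhds (by rw [he]; linarith))
  refine hasFDerivAt_flow hK ?_ (fun t w => ?_) hφ.zero ?_ hT
  · refine (hasFDerivAt_diagVec ha hb h1 h2).congr_of_eventuallyEq ?_
    filter_upwards [hev] with w hw using cutVec_eq_diagVec hw.le
  · rw [flow_eq_of_critical ha hb hH hφ h1 h2, add_right_comm]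
    have := cutVec_add ha hb e (z + w) (t * (a z.1.2 * z.2.1)) 0
    rwa [Int.cast_zero] at this
  · filter_upwards [hev] with w hw
    exact hasDerivAt_cutVec_of_diagVec ha hb
      (fun τ => hamVec_eq_diagVec ha hb hH ▸ hφ.hasDerivAt τ w) (by rw [hφ.zero]; exact hw.le)

theorem linearIndependent_diagVec {z : CotPlane} (h1 : deriv a z.1.2 = 0) (h2 : z.2.2 = 0)
    (h3 : a z.1.2 * z.2.1 ≠ 0) {u₁ u₂ v₁ v₂ : ℝ} (h : u₁ * v₂ - u₂ * v₁ ≠ 0) :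
    LinearIndependent ℝ
      ![diagVec a b z, (((0, u₁), (0, u₂)) : CotPlane), (((0, v₁), (0, v₂)) : CotPlane)] := by
  rw [Fintype.linearIndependent_iff]
  intro g hg
  simp only [Fin.sum_univ_three, Matrix.cons_val, diagVec, h1, h2, Prod.smul_mk, Prod.mk_add_mk,
    smul_eq_mul, mul_zero, zero_mul, add_zero, Prod.mk_eq_zero] at hg
  obtain ⟨⟨e0, e1⟩, -, e2⟩ := hg
  have g0 : g 0 = 0 := by simpa [h3] using e0
  have g1 : g 1 = 0 := (mul_eq_zero.1 (show g 1 * (u₁ * v₂ - u₂ * v₁) = 0 by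
    simp [g0] at e1 e2
    linear_combination v₂ * e1 - v₁ * e2)).resolve_right h
  have g2 : g 2 = 0 := (mul_eq_zero.1 (show g 2 * (u₁ * v₂ - u₂ * v₁) = 0 by
    simp [g0] at e1 e2
    linear_combination u₁ * e2 - u₂ * e1)).resolve_right h
  intro i
  fin_cases i
  exacts [g0, g1, g2]

/-- The transverse linearization δs' = b δp_s, δp_s' = -k δs with k > 0 is a harmonic oscillator of
frequency ν = √(b k), so its time `T` map is a rotation by ν T. -/
theorem isEllipticOrbit_momentumCircle (ha : IsCoefficient a) (hb : IsCoefficient b)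
    (hH : H ∘ cotProj = diagHam a b) {Φ : ℝ → CotPlane → CotPlane}
    {φ : ℝ → CotTorus → CotTorus} (hφ : IsHamiltonianFlow H Φ φ) {s c : ℝ} (hs : deriv a s = 0)
    (hs' : 0 < deriv (deriv a) s) (hc : c ≠ 0) : IsEllipticOrbit H Φ φ (momentumCircle s c) := by
  refine ⟨_, isPeriodicOrbit_momentumCircle ha hb hH hφ hs hc, fun z hz => ?_⟩
  obtain ⟨hzs, hzc⟩ := cotProj_mem_momentumCircle.1 hz
  have h1 : deriv a z.1.2 = 0 := (apply_eq_of_coe_eq (periodic_deriv ha.periodic) hzs).trans hs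
  have h2 : z.2.2 = 0 := by rw [hzc]
  have h3 : z.2.1 ≠ 0 := by rwa [hzc]
  have h4 : 0 < deriv (deriv a) z.1.2 :=
    (apply_eq_of_coe_eq (periodic_deriv (periodic_deriv ha.periodic)) hzs).symm ▸ hs'
  have ha0 := ha.pos z.1.2
  have hb0 := hb.pos z.1.2
  set T := |a s * c|⁻¹
  refine ⟨_, hasFDerivAt_flow_of_critical ha hb hH hφ h1 h2 (T := T) (by positivity), ?_⟩
  set L := parallelLin a b z with hL
  set k := deriv (deriv a) z.1.2 * z.2.1 ^ 2 / 2 with hk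
  have hk0 : 0 < k := by positivity
  set ν := Real.sqrt (b z.1.2 * k) with hν
  have hν2 : ν ^ 2 = b z.1.2 * k := Real.sq_sqrt (by positivity)
  have hν0 : 0 < ν := Real.sqrt_pos.2 (by positivity)
  set u : CotPlane := ((0, 1), (0, 0)) with hu
  -- Scaled so that `L u = ν • v` and `L v = -ν • u`: in this basis the oscillator is a rigid
  -- rotation.
  set v : CotPlane := ((0, 0), (0, -(k / ν))) with hv
  have hLu : L u = ν • v := by
    ext <;> simp [hL, parallelLin, u, v]
    rw [← hk]
    field_simp
  have hLv : L v = -ν • u := by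
    ext <;> simp [hL, parallelLin, u, v]
    field_simp
    exact hν2.symm
  have hcos : ∀ t, HasDerivAt (fun t => Real.cos (ν * t)) (-Real.sin (ν * t) * ν) t := fun t => by
    simpa using ((hasDerivAt_id t).const_mul ν).cos
  have hsin : ∀ t, HasDerivAt (fun t => Real.sin (ν * t)) (Real.cos (ν * t) * ν) t := fun t => by
    simpa using ((hasDerivAt_id t).const_mul ν).sin
  refine ⟨u, ?_, v, ?_, ?_, ν * T, 0, 0, ?_, ?_⟩
  · simp [mem_levelTangent ha hb hH, diagHamDeriv, u, h1, h2]
  · simp [mem_levelTangent ha hb hH, diagHamDeriv, v, h2]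
  · rw [hamVec_eq_diagVec ha hb hH]
    exact linearIndependent_diagVec h1 h2 (mul_ne_zero ha0.ne' h3) (by simp [hk0.ne', hν0.ne'])
  · have := eq_exp_smul_apply (L := L)
      (y := fun t => Real.cos (ν * t) • u + Real.sin (ν * t) • v) (fun t => ?_) T
    · simpa using this.symm
    · refine (((hcos t).smul_const u).add ((hsin t).smul_const v)).congr_deriv ?_
      rw [map_add, map_smul, map_smul, hLu, hLv]
      module
  · have := eq_exp_smul_apply (L := L)
      (y := fun t => -Real.sin (ν * t) • u + Real.cos (ν * t) • v) (fun t => ?_) T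
    · simpa using this.symm
    · refine (((hsin t).neg.smul_const u).add ((hcos t).smul_const v)).congr_deriv ?_
      rw [map_add, map_smul, map_smul, hLu, hLv]
      module

/-- Here δs' = b δp_s, δp_s' = k δs with k > 0: the vectors (δs, δp_s) = (b, ±l), l² = b k, are
eigenvectors for ±l, and time `T` exponentiates them. -/
theorem isHyperbolicOrbit_momentumCircle (ha : IsCoefficient a) (hb : IsCoefficient b)
    (hH : H ∘ cotProj = diagHam a b) {Φ : ℝ → CotPlane → CotPlane}
    {φ : ℝ → CotTorus → CotTorus} (hφ : IsHamiltonianFlow H Φ φ) {s c : ℝ} (hs : deriv a s = 0)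
    (hs' : deriv (deriv a) s < 0) (hc : c ≠ 0) :
    IsHyperbolicOrbit H Φ φ (momentumCircle s c) := by
  have hP := isPeriodicOrbit_momentumCircle ha hb hH hφ hs hc
  refine ⟨_, hP, fun z hz => ?_⟩
  obtain ⟨hzs, hzc⟩ := cotProj_mem_momentumCircle.1 hz
  have h1 : deriv a z.1.2 = 0 := (apply_eq_of_coe_eq (periodic_deriv ha.periodic) hzs).trans hs
  have h2 : z.2.2 = 0 := by rw [hzc]
  have h3 : z.2.1 ≠ 0 := by rwa [hzc]
  have h4 : deriv (deriv a) z.1.2 < 0 :=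
    (apply_eq_of_coe_eq (periodic_deriv (periodic_deriv ha.periodic)) hzs).symm ▸ hs'
  have ha0 := ha.pos z.1.2
  have hb0 := hb.pos z.1.2
  have hT0 := hP.1
  set T := |a s * c|⁻¹
  refine ⟨_, hasFDerivAt_flow_of_critical ha hb hH hφ h1 h2 hT0.le, ?_⟩
  set L := parallelLin a b z with hL
  set k := -(deriv (deriv a) z.1.2 * z.2.1 ^ 2 / 2) with hk
  have hk0 : 0 < k := by
    have : 0 < -deriv (deriv a) z.1.2 * z.2.1 ^ 2 / 2 := by
      have := neg_pos.2 h4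
      positivity
    rw [hk]
    linarith
  set l := Real.sqrt (b z.1.2 * k) with hl
  have hl2 : l ^ 2 = b z.1.2 * k := Real.sq_sqrt (by positivity)
  have hl0 : 0 < l := Real.sqrt_pos.2 (by positivity)
  have hLw : ∀ m : ℝ, m ^ 2 = b z.1.2 * k →
      L ((0, b z.1.2), (0, m)) = m • (((0, b z.1.2), (0, m)) : CotPlane) := by
    intro m hm
    ext <;> simp [hL, parallelLin]
    · ring
    · rw [hk] at hm
      linarith
  have hexp : ∀ m : ℝ, m ^ 2 = b z.1.2 * k →
      (NormedSpace.exp (T • L) : CotPlane →L[ℝ] CotPlane) ((0, b z.1.2), (0, m)) =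
        Real.exp (m * T) • (((0, b z.1.2), (0, m)) : CotPlane) := by
    intro m hm
    have := eq_exp_smul_apply (L := L)
      (y := fun t => Real.exp (m * t) • (((0, b z.1.2), (0, m)) : CotPlane)) (fun t => ?_) T
    · simpa using this.symm
    · have he : HasDerivAt (fun t => Real.exp (m * t)) (Real.exp (m * t) * m) t := by
        simpa using ((hasDerivAt_id t).const_mul m).exp
      have := he.smul_const (((0, b z.1.2), (0, m)) : CotPlane)
      rwa [mul_smul, ← hLw m hm, ← map_smul] at this
  have hmem : ∀ m : ℝ, (((0, b z.1.2), (0, m)) : CotPlane) ∈ levelTangent H z := fun m => by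
    simp [mem_levelTangent ha hb hH, diagHamDeriv, h1, h2]
  refine ⟨_, hmem l, _, hmem (-l), ?_, l * T, mul_pos hl0 hT0, hexp l hl2, ?_⟩
  · rw [hamVec_eq_diagVec ha hb hH]
    refine linearIndependent_diagVec h1 h2 (mul_ne_zero ha0.ne' h3) ?_
    have := mul_pos hb0 hl0
    exact ne_of_lt (by linarith)
  · rw [hexp (-l) (by rw [neg_sq, hl2]), neg_mul]

end

/-! ### The geodesic Hamiltonian of a torus of revolution -/

/-- The coefficient of `p_φ²` in the dual metric. -/
def angCoef (x : ℝ → ℝ) (s : ℝ) : ℝ := (4 * Real.pi ^ 2 * x s ^ 2)⁻¹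

/-- The coefficient of `p_s²` in the dual metric. -/
def merCoef (x y : ℝ → ℝ) (s : ℝ) : ℝ := (deriv x s ^ 2 + deriv y s ^ 2)⁻¹

section

variable {x y : ℝ → ℝ}

theorem hasFDerivAt_surfaceMap (h : IsTorusProfile x y) (q : ℝ × ℝ) :
    HasFDerivAt (surfaceMap x y) (fderiv ℝ (surfaceMap x y) q) q := by
  have hx := h.smooth_x.differentiable (by simp)
  have hy := h.smooth_y.differentiable (by simp)
  refine DifferentiableAt.hasFDerivAt (differentiable_euclidean.2 (fun i => ?_) q)
  fin_cases i
  · change Differentiable ℝ fun q : ℝ × ℝ => x q.2 * Real.cos (2 * Real.pi * q.1)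
    fun_prop
  · change Differentiable ℝ fun q : ℝ × ℝ => x q.2 * Real.sin (2 * Real.pi * q.1)
    fun_prop
  · change Differentiable ℝ fun q : ℝ × ℝ => y q.2
    fun_prop

/-- Reduces the partial derivatives to one-variable ones along a line, component by component. -/
theorem fderiv_surfaceMap_eq (h : IsTorusProfile x y) {q v : ℝ × ℝ}
    {c : Fin 3 → ℝ} (hc : ∀ i, HasDerivAt (fun t : ℝ => surfaceMap x y (q + t • v) i) (c i) 0) :
    fderiv ℝ (surfaceMap x y) q v = WithLp.toLp 2 c := by
  have hl : HasDerivAt (fun t : ℝ => q + t • v) v 0 := by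
    simpa using ((hasDerivAt_id (0 : ℝ)).smul_const v).const_add q
  ext i
  have h1 : HasFDerivAt (surfaceMap x y) (fderiv ℝ (surfaceMap x y) q) (q + (0 : ℝ) • v) := by
    simpa using hasFDerivAt_surfaceMap h q
  have h2 := (EuclideanSpace.proj (𝕜 := ℝ) i).hasFDerivAt.comp_hasDerivAt (0 : ℝ)
    (h1.comp_hasDerivAt (0 : ℝ) hl)
  exact h2.unique (hc i)

theorem fderiv_surfaceMap_phi (h : IsTorusProfile x y) (q : ℝ × ℝ) :
    fderiv ℝ (surfaceMap x y) q (1, 0) =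
      !₂[-(2 * Real.pi * x q.2 * Real.sin (2 * Real.pi * q.1)),
        2 * Real.pi * x q.2 * Real.cos (2 * Real.pi * q.1), 0] := by
  have hl : HasDerivAt (fun t : ℝ => 2 * Real.pi * (q.1 + t)) (2 * Real.pi) 0 := by
    simpa using ((hasDerivAt_id (0 : ℝ)).const_add q.1).const_mul (2 * Real.pi)
  refine fderiv_surfaceMap_eq h fun i => ?_
  fin_cases i
  · refine ((hl.cos.const_mul (x q.2)).congr_of_eventuallyEq
      (.of_forall fun t => by simp [surfaceMap])).congr_deriv ?_
    simp
    ring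
  · refine ((hl.sin.const_mul (x q.2)).congr_of_eventuallyEq
      (.of_forall fun t => by simp [surfaceMap])).congr_deriv ?_
    simp
    ring
  · simpa [surfaceMap] using hasDerivAt_const (0 : ℝ) (y q.2)

theorem fderiv_surfaceMap_s (h : IsTorusProfile x y) (q : ℝ × ℝ) :
    fderiv ℝ (surfaceMap x y) q (0, 1) =
      !₂[deriv x q.2 * Real.cos (2 * Real.pi * q.1),
        deriv x q.2 * Real.sin (2 * Real.pi * q.1), deriv y q.2] := by
  have hx : HasDerivAt (fun t : ℝ => x (q.2 + t)) (deriv x q.2) 0 := by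
    have := (h.smooth_x.differentiable (by simp) (q.2 + 0)).hasDerivAt.comp_const_add q.2 0
    rwa [add_zero] at this
  have hy : HasDerivAt (fun t : ℝ => y (q.2 + t)) (deriv y q.2) 0 := by
    have := (h.smooth_y.differentiable (by simp) (q.2 + 0)).hasDerivAt.comp_const_add q.2 0
    rwa [add_zero] at this
  refine fderiv_surfaceMap_eq h fun i => ?_
  fin_cases i
  · simpa [surfaceMap] using hx.mul_const (Real.cos (2 * Real.pi * q.1))
  · simpa [surfaceMap] using hx.mul_const (Real.sin (2 * Real.pi * q.1))
  · simpa [surfaceMap] using hy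

/-- The metric is diagonal in the coordinates `(φ, s)`. -/
theorem metricMatrix_eq (h : IsTorusProfile x y) (q : ℝ × ℝ) :
    metricMatrix x y q = Matrix.diagonal
      ![4 * Real.pi ^ 2 * x q.2 ^ 2, deriv x q.2 ^ 2 + deriv y q.2 ^ 2] := by
  have hsc := Real.sin_sq_add_cos_sq (2 * Real.pi * q.1)
  ext i j
  fin_cases i <;> fin_cases j <;>
    simp [metricMatrix, coordVec, fderiv_surfaceMap_phi h, fderiv_surfaceMap_s h,
      EuclideanSpace.inner_eq_star_dotProduct, Matrix.vecHead, Matrix.vecTail]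
  · linear_combination (4 * Real.pi ^ 2 * x q.2 ^ 2) * hsc
  · ring
  · ring
  · linear_combination (deriv x q.2 ^ 2) * hsc

theorem isCoefficient_profile (h : IsTorusProfile x y) : IsCoefficient x :=
  ⟨h.smooth_x, h.periodic_x, h.pos_x⟩

theorem isCoefficient_angCoef (h : IsTorusProfile x y) : IsCoefficient (angCoef x) where
  smooth := by
    have := h.smooth_x
    have h0 := fun s => (h.pos_x s).ne'
    unfold angCoef
    exact ContDiff.inv (by fun_prop) fun s => by simp [h0 s, Real.pi_ne_zero]
  periodic s := by simp [angCoef, h.periodic_x s]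
  pos s := by
    have := h.pos_x s
    unfold angCoef
    positivity

theorem isCoefficient_merCoef (h : IsTorusProfile x y) : IsCoefficient (merCoef x y) where
  smooth := by
    have := (contDiff_infty_iff_deriv.1 h.smooth_x).2
    have := (contDiff_infty_iff_deriv.1 h.smooth_y).2
    unfold merCoef
    exact ContDiff.inv (by fun_prop) fun s => (h.regular s).ne'
  periodic s := by
    simp [merCoef, periodic_deriv h.periodic_x s, periodic_deriv h.periodic_y s]
  pos s := inv_pos.2 (h.regular s)

theorem planeHamiltonian_eq (h : IsTorusProfile x y) :
    planeHamiltonian x y = diagHam (angCoef x) (merCoef x y) := by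
  funext z
  have h1 : 4 * Real.pi ^ 2 * x z.1.2 ^ 2 ≠ 0 := by
    have := h.pos_x z.1.2
    positivity
  have hinv : (metricMatrix x y z.1)⁻¹ =
      Matrix.diagonal ![angCoef x z.1.2, merCoef x y z.1.2] := by
    refine Matrix.inv_eq_right_inv ?_
    rw [metricMatrix_eq h, Matrix.diagonal_mul_diagonal, ← Matrix.diagonal_one]
    congr 1
    ext i
    fin_cases i
    · simpa [angCoef] using mul_inv_cancel₀ h1
    · simpa [merCoef] using mul_inv_cancel₀ (h.regular z.1.2).ne'
  simp [planeHamiltonian, hinv, diagHam, Matrix.vecHead, Matrix.vecTail]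
  ring

theorem torusHamiltonian_comp_cotProj (h : IsTorusProfile x y) :
    torusHamiltonian x y ∘ cotProj = diagHam (angCoef x) (merCoef x y) := by
  rw [← planeHamiltonian_eq h]
  exact funext fun z => torusHamiltonian_cotProj h.periodic_x h.periodic_y z

theorem deriv_angCoef (h : IsTorusProfile x y) (s : ℝ) :
    deriv (angCoef x) s = -(2 * Real.pi ^ 2 * x s ^ 3)⁻¹ * deriv x s := by
  have hx := (isCoefficient_profile h).hasDerivAt s
  have h0 := (h.pos_x s).ne'
  have h1 : 4 * Real.pi ^ 2 * x s ^ 2 ≠ 0 := by simp [h0, Real.pi_ne_zero]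
  have h2 : HasDerivAt (angCoef x) _ s := ((hx.pow 2).const_mul (4 * Real.pi ^ 2)).inv h1
  rw [h2.deriv]
  have := Real.pi_ne_zero
  simp
  field_simp
  ring

theorem deriv_angCoef_eq_zero_iff (h : IsTorusProfile x y) {s : ℝ} :
    deriv (angCoef x) s = 0 ↔ deriv x s = 0 := by
  rw [deriv_angCoef h]
  simp [(h.pos_x s).ne', Real.pi_ne_zero]

/-- Differentiating the prefactor leaves a multiple of x'(s) = 0. The negative sign exchanges the
maxima of `x` with the minima of `angCoef x`. -/
theorem deriv_deriv_angCoef (h : IsTorusProfile x y) {s : ℝ} (hs : deriv x s = 0) :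
    deriv (deriv (angCoef x)) s = -(2 * Real.pi ^ 2 * x s ^ 3)⁻¹ * deriv (deriv x) s := by
  have hx := (isCoefficient_profile h).hasDerivAt s
  have hx' := (isCoefficient_profile h).hasDerivAt_deriv s
  have h1 : 2 * Real.pi ^ 2 * x s ^ 3 ≠ 0 := by simp [(h.pos_x s).ne', Real.pi_ne_zero]
  have h2 := (((hx.pow 3).const_mul (2 * Real.pi ^ 2)).inv h1).neg.mul hx'
  rw [funext (deriv_angCoef h)]
  refine (h2.deriv).trans ?_
  simp [hs]

theorem deriv_deriv_angCoef_ne_zero (h : IsMorseTorusProfile x y) (s : ℝ)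
    (hs : deriv (angCoef x) s = 0) : deriv (deriv (angCoef x)) s ≠ 0 := by
  rw [deriv_angCoef_eq_zero_iff h.toIsTorusProfile] at hs
  rw [deriv_deriv_angCoef h.toIsTorusProfile hs]
  simp [(h.pos_x s).ne', Real.pi_ne_zero, h.morse s hs]

/-! ### The critical circles -/

theorem parallelMomentum_pos (h : IsTorusProfile x y) {e : ℝ} (he : 0 < e) (s : ℝ) :
    0 < 2 * Real.pi * Real.sqrt (2 * e) * x s := by
  have := h.pos_x s
  positivity

theorem critSet_eq (h : IsTorusProfile x y) {e : ℝ} (he : 0 < e) :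
    critSet (torusHamiltonian x y) clairaut e =
      {z | ∃ s σ : ℝ, deriv x s = 0 ∧ (σ = 1 ∨ σ = -1) ∧ z ∈ parallelCircle x e s σ} := by
  have hmem : ∀ {z : CotPlane}, z ∈ critLift (torusHamiltonian x y) clairaut e ↔ _ :=
    mem_critLift_clairaut (isCoefficient_angCoef h) (isCoefficient_merCoef h)
      (torusHamiltonian_comp_cotProj h) he
  -- With p_s = 0 the energy equation is p_φ² / (4π²x²) = 2e.
  have henergy : ∀ z : CotPlane, z.2.2 = 0 → (diagHam (angCoef x) (merCoef x y) z = e ↔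
      z.2.1 ^ 2 = (2 * Real.pi * Real.sqrt (2 * e) * x z.1.2) ^ 2) := by
    intro z hz
    have h1 : 0 < 4 * Real.pi ^ 2 * x z.1.2 ^ 2 := by
      have := h.pos_x z.1.2
      positivity
    have h2 : (2 * Real.pi * Real.sqrt (2 * e) * x z.1.2) ^ 2 =
        4 * Real.pi ^ 2 * x z.1.2 ^ 2 * (2 * e) := by
      rw [mul_pow, mul_pow, Real.sq_sqrt (by positivity)]
      ring
    rw [h2, diagHam, hz, angCoef, inv_mul_eq_div, div_eq_iff two_ne_zero]
    simp only [ne_eq, OfNat.ofNat_ne_zero, not_false_eq_true, zero_pow, mul_zero, add_zero]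
    rw [div_eq_iff h1.ne']
    constructor <;> intro h3 <;> linarith
  ext w
  constructor
  · rintro ⟨z, hz, rfl⟩
    obtain ⟨h0, h1, h2⟩ := hmem.1 hz
    rw [deriv_angCoef_eq_zero_iff h] at h1
    rcases sq_eq_sq_iff_eq_or_eq_neg.1 ((henergy z h2).1 h0) with h3 | h3
    · exact ⟨z.1.2, 1, h1, .inl rfl, cotProj_mem_momentumCircle.2
        ⟨rfl, Prod.ext (by simpa using h3) h2⟩⟩
    · exact ⟨z.1.2, -1, h1, .inr rfl, cotProj_mem_momentumCircle.2
        ⟨rfl, Prod.ext (by simpa using h3) h2⟩⟩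
  · rintro ⟨s, σ, hs, hσ, φ, rfl⟩
    obtain ⟨φ, rfl⟩ := QuotientAddGroup.mk_surjective φ
    refine ⟨((φ, s), (σ * (2 * Real.pi * Real.sqrt (2 * e) * x s), 0)), hmem.2
      ⟨(henergy _ rfl).2 ?_, (deriv_angCoef_eq_zero_iff h).2 hs, rfl⟩, rfl⟩
    rcases hσ with rfl | rfl <;> ring

/-- Zeros of x' with x'' ≠ 0 are isolated, and a discrete subspace of ℝ is separable, hence
countable. -/
theorem countable_setOf_deriv_eq_zero (h : IsMorseTorusProfile x y) :
    {s | deriv x s = 0}.Countable := by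
  have hd : DiscreteTopology {s | deriv x s = 0} := by
    rw [discreteTopology_subtype_iff]
    intro s hs
    exact Filter.inf_principal_eq_bot.2
      (((isCoefficient_profile h.toIsTorusProfile).hasDerivAt_deriv s).eventually_ne (h.morse s hs))
  exact TopologicalSpace.separableSpace_iff_countable.1 inferInstance

theorem parallelCircle_congr (h : IsTorusProfile x y) (e σ : ℝ) {s t : ℝ}
    (hst : (s : UnitAddCircle) = t) : parallelCircle x e s σ = parallelCircle x e t σ := by
  rw [parallelCircle, parallelCircle, hst, apply_eq_of_coe_eq h.periodic_x hst]

theorem continuous_parallel (s c : ℝ) :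
    Continuous fun φ : UnitAddCircle => (((φ, (s : UnitAddCircle)), (c, 0)) : CotTorus) := by
  fun_prop

/-- The circles over the critical parallels are the connected components of the critical set. -/
theorem connectedComponentIn_critSet (h : IsMorseTorusProfile x y) {e : ℝ} (he : 0 < e) {s σ : ℝ}
    (hs : deriv x s = 0) (hσ : σ = 1 ∨ σ = -1) {z : CotTorus} (hz : z ∈ parallelCircle x e s σ) :
    connectedComponentIn (critSet (torusHamiltonian x y) clairaut e) z =
      parallelCircle x e s σ := by
  have hsub : parallelCircle x e s σ ⊆ critSet (torusHamiltonian x y) clairaut e := by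
    rw [critSet_eq h.toIsTorusProfile he]
    exact fun w hw => ⟨s, σ, hs, hσ, hw⟩
  refine Set.Subset.antisymm (fun w hw => ?_)
    ((isPreconnected_range (continuous_parallel s _)).subset_connectedComponentIn hz hsub)
  have hP : ({p | ∃ t τ : ℝ, deriv x t = 0 ∧ (τ = 1 ∨ τ = -1) ∧
      p = τ * (2 * Real.pi * Real.sqrt (2 * e) * x t)} : Set ℝ).Countable := by
    refine ((((Set.countable_singleton (-1 : ℝ)).insert 1).prod
      (countable_setOf_deriv_eq_zero h)).image
        fun q : ℝ × ℝ => q.1 * (2 * Real.pi * Real.sqrt (2 * e) * x q.2)).mono ?_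
    rintro _ ⟨t, τ, ht, hτ, rfl⟩
    exact ⟨(τ, t), ⟨hτ, ht⟩, rfl⟩
  have hcl : Continuous clairaut := continuous_fst.comp continuous_snd
  -- The image of the component under p_φ is connected and lies in a countable set of reals, hence
  -- is a point.
  have heq : clairaut w = clairaut z := by
    refine hP.isTotallyDisconnected _ ?_
      (isPreconnected_connectedComponentIn.image clairaut hcl.continuousOn) ⟨w, hw, rfl⟩
      ⟨z, mem_connectedComponentIn (hsub hz), rfl⟩
    rintro _ ⟨v, hv, rfl⟩
    have := connectedComponentIn_subset _ _ hv
    rw [critSet_eq h.toIsTorusProfile he] at this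
    obtain ⟨t, τ, ht, hτ, φ, rfl⟩ := this
    exact ⟨t, τ, ht, hτ, rfl⟩
  have hw' := connectedComponentIn_subset _ _ hw
  rw [critSet_eq h.toIsTorusProfile he] at hw'
  obtain ⟨t, τ, ht, hτ, φ, rfl⟩ := hw'
  obtain ⟨ψ, rfl⟩ := hz
  simp only [clairaut] at heq
  have hps := parallelMomentum_pos h.toIsTorusProfile he s
  have hpt := parallelMomentum_pos h.toIsTorusProfile he t
  have hk : 0 < 2 * Real.pi * Real.sqrt (2 * e) := by positivity
  -- `x` and √(2e) are positive, so equal momenta have equal signs and equal critical values;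
  -- distinctness of critical values then identifies the parallels.
  have key : τ = σ ∧ x t = x s := by
    rcases hτ with rfl | rfl <;> rcases hσ with rfl | rfl
    · exact ⟨rfl, mul_left_cancel₀ hk.ne' (by linarith)⟩
    · linarith
    · linarith
    · exact ⟨rfl, mul_left_cancel₀ hk.ne' (by linarith)⟩
  obtain ⟨rfl, hx⟩ := key
  rw [← parallelCircle_congr h.toIsTorusProfile e τ (h.once t s ht hs hx)]
  exact ⟨φ, rfl⟩

/-- A continuous injection of a compact space into a Hausdorff one is a closed embedding. -/
theorem nonempty_homeomorph_momentumCircle (s c : ℝ) :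
    Nonempty (momentumCircle s c ≃ₜ UnitAddCircle) := by
  have := (continuous_parallel s c).isClosedEmbedding fun φ ψ hφψ => by simpa using hφψ
  exact ⟨this.isEmbedding.toHomeomorph.symm⟩

theorem isCriticalCircle_iff (h : IsMorseTorusProfile x y) {e : ℝ} (he : 0 < e)
    (C : Set CotTorus) : IsCriticalCircle (torusHamiltonian x y) clairaut e C ↔
      ∃ s σ : ℝ, deriv x s = 0 ∧ (σ = 1 ∨ σ = -1) ∧ C = parallelCircle x e s σ := by
  constructor
  · rintro ⟨⟨z, hz, rfl⟩, -⟩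
    rw [critSet_eq h.toIsTorusProfile he] at hz
    obtain ⟨s, σ, hs, hσ, hz⟩ := hz
    exact ⟨s, σ, hs, hσ, connectedComponentIn_critSet h he hs hσ hz⟩
  · rintro ⟨s, σ, hs, hσ, rfl⟩
    obtain ⟨z, hz⟩ : (parallelCircle x e s σ).Nonempty := Set.range_nonempty _
    refine ⟨⟨z, ?_, (connectedComponentIn_critSet h he hs hσ hz).symm⟩,
      nonempty_homeomorph_momentumCircle s _⟩
    rw [critSet_eq h.toIsTorusProfile he]
    exact ⟨s, σ, hs, hσ, hz⟩

/-! ### Stability type from the sign of x'' -/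

section Stability

variable {e s σ : ℝ} {Φ : ℝ → CotPlane → CotPlane} {φ : ℝ → CotTorus → CotTorus}

theorem isEllipticOrbit_parallelCircle (h : IsTorusProfile x y) (he : 0 < e)
    (hφ : IsHamiltonianFlow (torusHamiltonian x y) Φ φ) (hσ : σ = 1 ∨ σ = -1)
    (hs : deriv x s = 0) (hs' : deriv (deriv x) s < 0) :
    IsEllipticOrbit (torusHamiltonian x y) Φ φ (parallelCircle x e s σ) := by
  have h0 := h.pos_x s
  have h1 : 0 < (2 * Real.pi ^ 2 * x s ^ 3)⁻¹ := by positivity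
  refine isEllipticOrbit_momentumCircle (isCoefficient_angCoef h) (isCoefficient_merCoef h)
    (torusHamiltonian_comp_cotProj h) hφ ((deriv_angCoef_eq_zero_iff h).2 hs) ?_
    (mul_ne_zero ?_ (parallelMomentum_pos h he s).ne')
  · rw [deriv_deriv_angCoef h hs]
    nlinarith
  · rcases hσ with rfl | rfl <;> norm_num

theorem isHyperbolicOrbit_parallelCircle (h : IsTorusProfile x y) (he : 0 < e)
    (hφ : IsHamiltonianFlow (torusHamiltonian x y) Φ φ) (hσ : σ = 1 ∨ σ = -1)
    (hs : deriv x s = 0) (hs' : 0 < deriv (deriv x) s) :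
    IsHyperbolicOrbit (torusHamiltonian x y) Φ φ (parallelCircle x e s σ) := by
  have h0 := h.pos_x s
  have h1 : 0 < (2 * Real.pi ^ 2 * x s ^ 3)⁻¹ := by positivity
  refine isHyperbolicOrbit_momentumCircle (isCoefficient_angCoef h) (isCoefficient_merCoef h)
    (torusHamiltonian_comp_cotProj h) hφ ((deriv_angCoef_eq_zero_iff h).2 hs) ?_
    (mul_ne_zero ?_ (parallelMomentum_pos h he s).ne')
  · rw [deriv_deriv_angCoef h hs]
    nlinarith
  · rcases hσ with rfl | rfl <;> norm_num

end Stability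

theorem deriv_deriv_eq_zero_of_isLocalMin_of_isLocalMax {f : ℝ → ℝ} {s : ℝ} (h1 : IsLocalMin f s)
    (h2 : IsLocalMax f s) : deriv (deriv f) s = 0 := by
  have h3 : f =ᶠ[nhds s] fun _ => f s := by
    filter_upwards [h1, h2] with t ht1 ht2 using le_antisymm ht2 ht1
  rw [h3.deriv.deriv_eq]
  simp

/-- Otherwise x'' > 0 by the Morse condition, so `s` is also a local minimum; then `x` is locally
constant and x'' = 0, a contradiction. -/
theorem deriv_deriv_neg_of_isLocalMax (h : IsMorseTorusProfile x y) {s : ℝ}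
    (hs : deriv x s = 0) (hmax : IsLocalMax x s) : deriv (deriv x) s < 0 := by
  by_contra! hc
  exact h.morse s hs (deriv_deriv_eq_zero_of_isLocalMin_of_isLocalMax
    (isLocalMin_of_deriv_deriv_pos (hc.lt_of_ne (h.morse s hs).symm) hs
      h.smooth_x.continuous.continuousAt) hmax)

theorem deriv_deriv_pos_of_isLocalMin (h : IsMorseTorusProfile x y) {s : ℝ}
    (hs : deriv x s = 0) (hmin : IsLocalMin x s) : 0 < deriv (deriv x) s := by
  by_contra! hc
  exact h.morse s hs (deriv_deriv_eq_zero_of_isLocalMin_of_isLocalMax hmin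
    (isLocalMax_of_deriv_deriv_neg (hc.lt_of_ne (h.morse s hs)) hs
      h.smooth_x.continuous.continuousAt))

end

end RevolutionTorus

end

theorem proposition4p1 (x y : ℝ → ℝ) (hxy : IsMorseTorusProfile x y) (e : ℝ) (he : 0 < e) :
    -- the geodesic flow on `T*𝕋²` exists for all times
    (∃ Φ φ, IsHamiltonianFlow (torusHamiltonian x y) Φ φ) ∧
    ∀ (Φ : ℝ → CotPlane → CotPlane) (φ : ℝ → CotTorus → CotTorus),
      IsHamiltonianFlow (torusHamiltonian x y) Φ φ →
      -- the system is dynamically coherent (in particular a nondegenerate Bott system)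
      IsDynamicallyCoherent (torusHamiltonian x y) clairaut e Φ φ ∧
      -- the critical points form the circles over the critical points of `x`
      (critSet (torusHamiltonian x y) clairaut e =
        {z | ∃ s σ : ℝ, deriv x s = 0 ∧ (σ = 1 ∨ σ = -1) ∧ z ∈ parallelCircle x e s σ}) ∧
      (∀ C, IsCriticalCircle (torusHamiltonian x y) clairaut e C ↔
        ∃ s σ : ℝ, deriv x s = 0 ∧ (σ = 1 ∨ σ = -1) ∧ C = parallelCircle x e s σ) ∧
      -- they are elliptic over the maxima and hyperbolic over the minima of `x`
      (∀ s σ : ℝ, (σ = 1 ∨ σ = -1) → deriv x s = 0 → IsLocalMax x s →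
        IsEllipticOrbit (torusHamiltonian x y) Φ φ (parallelCircle x e s σ)) ∧
      (∀ s σ : ℝ, (σ = 1 ∨ σ = -1) → deriv x s = 0 → IsLocalMin x s →
        IsHyperbolicOrbit (torusHamiltonian x y) Φ φ (parallelCircle x e s σ)) ∧
      -- there is a hyperbolic orbit
      ∃ C, IsCriticalCircle (torusHamiltonian x y) clairaut e C ∧
        IsHyperbolicOrbit (torusHamiltonian x y) Φ φ C := by
  have h := hxy.toIsTorusProfile
  have ha := isCoefficient_angCoef h
  have hb := isCoefficient_merCoef h
  have hH := torusHamiltonian_comp_cotProj h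
  refine ⟨exists_isHamiltonianFlow ha hb hH, fun Φ φ hφ => ⟨⟨isBottSystem_clairaut ha hb hH he
    (deriv_deriv_angCoef_ne_zero hxy) hφ, fun C hC => ?_⟩, critSet_eq h he,
    isCriticalCircle_iff hxy he, fun s σ hσ hs hmax => ?_, fun s σ hσ hs hmin => ?_, ?_⟩⟩
  · obtain ⟨s, σ, hs, hσ, rfl⟩ := (isCriticalCircle_iff hxy he C).1 hC
    rcases lt_or_gt_of_ne (hxy.morse s hs) with hs' | hs'
    · exact .inl (isEllipticOrbit_parallelCircle h he hφ hσ hs hs')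
    · exact .inr (isHyperbolicOrbit_parallelCircle h he hφ hσ hs hs')
  · exact isEllipticOrbit_parallelCircle h he hφ hσ hs (deriv_deriv_neg_of_isLocalMax hxy hs hmax)
  · exact isHyperbolicOrbit_parallelCircle h he hφ hσ hs
      (deriv_deriv_pos_of_isLocalMin hxy hs hmin)
  -- Periodicity gives `x` a global minimum, whose parallel is hyperbolic.
  · obtain ⟨s, hs⟩ := (isCoefficient_profile h).exists_forall_le
    have hmin : IsLocalMin x s := .of_forall hs
    have hs0 := hmin.deriv_eq_zero
    exact ⟨parallelCircle x e s 1, (isCriticalCircle_iff hxy he _).2 ⟨s, 1, hs0, .inl rfl, rfl⟩,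
      isHyperbolicOrbit_parallelCircle h he hφ (.inl rfl) hs0
        (deriv_deriv_pos_of_isLocalMin hxy hs0 hmin)⟩
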